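/- Let $\psi:\mathbb R\to\mathbb R$ be a strictly increasing $C^1$-diffeomorphism with $\psi'>0$ and $\psi(t)\to\pm\infty$ as $t\to\pm\infty$, let $\omega:\mathbb R\to(0,\infty)$ be measurable with $\omega,1/\omega\in L^\infty_{\rm loc}(\mathbb R)$, and let $0<\alpha<1$, $\lambda>0$. Let $L^1_{\psi,\omega}$ be the space of measurable $u:\mathbb R\to\mathbb C$ with $\int_{\mathbb R}|u|\,\omega\,\psi'\,dt<\infty$. For $u\in L^1_{\psi,\omega}$ put $$\hat u_{\psi,\omega}(\xi)=\frac1{\sqrt{2\pi}}\int_{\mathbb R}u(t)e^{-i\xi\psi(t)}\omega(t)\psi'(t)\,dt,$$ and define the weighted convolution (the ordinary convolution conjugated by $u\mapsto(\omega u)\circ\psi^{-1}$) $$(u*_{\psi,\omega}v)(t)=\frac1{\omega(t)}\int_{\mathbb R}(\omega u)\bigl(\psi^{-1}(\psi(t)-\psi(\tau))\bigr)\,v(\tau)\,\omega(\tau)\psi'(\tau)\,d\tau ,$$ the weighted Weyl integral (for $\beta>0$) and derivative $$\mathfrak I^{\beta}_{\psi,\omega}u(t)=\frac1{\Gamma(\beta)\omega(t)}\int_{-\infty}^t(\psi(t)-\psi(\tau))^{\beta-1}\omega(\tau)u(\tau)\psi'(\tau)\,d\tau,\qquad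 \mathfrak D^\alpha_{\psi,\omega}u=\frac1{\omega\psi'}\frac{d}{dt}\bigl(\omega\,\mathfrak I^{1-\alpha}_{\psi,\omega}u\bigr),$$ where $u$ is in the domain of $\mathfrak D^\alpha_{\psi,\omega}$ if $\mathfrak I^{1-\alpha}_{\psi,\omega}u$ converges absolutely a.e. and $\omega\,\mathfrak I^{1-\alpha}_{\psi,\omega}u$ coincides a.e. with a locally absolutely continuous function, whose derivative is then used. Finally let $E_{\alpha,\alpha}(x)=\sum_{k\ge0}x^k/\Gamma(\alpha k+\alpha)$, let $\Theta$ be the indicator function of $(0,\infty)$, and let $$\mathcal G(t)=\frac1{\omega(t)}\,\psi(t)^{\alpha-1}E_{\alpha,\alpha}\bigl(-\lambda\psi(t)^\alpha\bigr)\,\Theta(\psi(t)).$$ **Theorem.** 1. $\mathcal G\in L^1_{\psi,\omega}$, and $\mathcal G$ is, up to a.e. equality, the unique element of $L^1_{\psi,\omega}$ with $\sqrt{2\pi}\,\hat{\mathcal G}_{\psi,\omega}(\xi)=\bigl((i\xi)^\alpha+\lambda\bigr)^{-1}$ for all $\xi\in\mathbb R$ (principal branch). 2. For every $f\in L^1_{\psi,\omega}$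 the integral defining $\sigma=\mathcal G*_{\psi,\omega}f$ converges absolutely for a.e. $t$. This $\sigma$ lies in $L^1_{\psi,\omega}$ and in the domain of $\mathfrak D^\alpha_{\psi,\omega}$, and it satisfies $$\mathfrak D^\alpha_{\psi,\omega}\sigma+\lambda\sigma=f\quad\text{a.e. on }\mathbb R;$$ moreover $\omega\,\mathfrak I^{1-\alpha}_{\psi,\omega}\sigma$ is itself locally absolutely continuous. It is, up to a.e. equality, the only solution of this equation in $L^1_{\psi,\omega}$ that lies in the domain of $\mathfrak D^\alpha_{\psi,\omega}$. It is causal: if $f,g\in L^1_{\psi,\omega}$ agree a.e. on $(-\infty,T]$, then $\mathcal G*_{\psi,\omega}f=\mathcal G*_{\psi,\omega}g$ on $(-\infty,T]$. Explicitly, $$\sigma(t)=\frac1{\omega(t)}\int_{-\infty}^t(\psi(t)-\psi(\tau))^{\alpha-1}E_{\alpha,\alpha}\bigl(-\lambda(\psi(t)-\psi(\tau))^\alpha\bigr)f(\tau)\,\omega(\tau)\,\psi'(\tau)\,d\tau .$$ -/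

import Mathlib

open MeasureTheory Filter Topology Set

noncomputable section

namespace WeightedWeyl

/-- The measure `ω(t) ψ'(t) dt`; the space `L¹_{ψ,ω}` is `Integrable · (weightedMeasure ψ ω)`. -/
def weightedMeasure (ψ ω : ℝ → ℝ) : Measure ℝ :=
  volume.withDensity (fun t => ENNReal.ofReal (ω t * deriv ψ t))

/-- Integrand (in `τ`) of the weighted Weyl integral of order `β`, without the factor
`1 / (Γ(β) ω(t))`. -/
def weylIntegrand (ψ ω : ℝ → ℝ) (β : ℝ) (u : ℝ → ℂ) (t τ : ℝ) : ℂ :=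
  (((ψ t - ψ τ) ^ (β - 1) * ω τ * deriv ψ τ : ℝ) : ℂ) * u τ

/-- The weighted `ψ`-Weyl integral
`(1 / (Γ(β) ω(t))) ∫_{-∞}^t (ψ(t) - ψ(τ))^{β-1} ω(τ) u(τ) ψ'(τ) dτ`. -/
def weylIntegral (ψ ω : ℝ → ℝ) (β : ℝ) (u : ℝ → ℂ) (t : ℝ) : ℂ :=
  ((1 / (Real.Gamma β * ω t) : ℝ) : ℂ) * ∫ τ in Iic t, weylIntegrand ψ ω β u t τ

/-- The weighted `ψ`-Weyl derivative `(1 / (ω ψ')) (d/dt) (ω · I^{1-α} u)`, as a pointwise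
expression (meaningful where the derivative exists). -/
def weylDeriv (ψ ω : ℝ → ℝ) (α : ℝ) (u : ℝ → ℂ) (t : ℝ) : ℂ :=
  ((1 / (ω t * deriv ψ t) : ℝ) : ℂ) *
    deriv (fun s => (ω s : ℂ) * weylIntegral ψ ω (1 - α) u s) t

/-- `u` lies in the domain of the weighted `ψ`-Weyl derivative and `v` is that derivative:
the integral defining `I^{1-α} u` converges absolutely almost everywhere, `ω · I^{1-α} u` agrees
almost everywhere with a locally absolutely continuous function `U`, and `v = U' / (ω ψ')` almost
everywhere. (Absolute continuity cannot be dropped: without it the Green's function itself would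
solve the homogeneous equation almost everywhere.) -/
def HasWeylDeriv (ψ ω : ℝ → ℝ) (α : ℝ) (u v : ℝ → ℂ) : Prop :=
  (∀ᵐ t : ℝ, IntegrableOn (weylIntegrand ψ ω (1 - α) u t) (Iic t)) ∧
  ∃ U : ℝ → ℂ,
    (∀ a b : ℝ, AbsolutelyContinuousOnInterval U a b) ∧
    (∀ᵐ t : ℝ, U t = (ω t : ℂ) * weylIntegral ψ ω (1 - α) u t) ∧
    (∀ᵐ t : ℝ, v t = ((1 / (ω t * deriv ψ t) : ℝ) : ℂ) * deriv U t)

/-- `σ ∈ L¹_{ψ,ω}` solves `D^α σ + lam σ = f` on `ℝ`. -/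
def IsSolution (ψ ω : ℝ → ℝ) (α lam : ℝ) (f σ : ℝ → ℂ) : Prop :=
  Integrable σ (weightedMeasure ψ ω) ∧
  ∃ v : ℝ → ℂ, HasWeylDeriv ψ ω α σ v ∧ ∀ᵐ t : ℝ, v t + (lam : ℂ) * σ t = f t

/-- The two-parameter Mittag-Leffler function `∑ x^k / Γ(α k + β)` at a real argument. -/
def mittagLeffler (α β x : ℝ) : ℝ := ∑' k : ℕ, x ^ k / Real.Gamma (α * k + β)

/-- The symmetric weighted Fourier transform
`(2π)^{-1/2} ∫ u(t) e^{-iξψ(t)} ω(t) ψ'(t) dt`. -/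
def weightedFourier (ψ ω : ℝ → ℝ) (u : ℝ → ℂ) (ξ : ℝ) : ℂ :=
  ((1 / Real.sqrt (2 * Real.pi) : ℝ) : ℂ) *
    ∫ t : ℝ, u t * Complex.exp (-(Complex.I * ξ * ψ t)) * ((ω t * deriv ψ t : ℝ) : ℂ)

/-- Integrand (in `τ`) of the weighted convolution, without the factor `1 / ω(t)`.
Here `Function.invFun ψ` is the inverse of the bijection `ψ`. -/
def convIntegrand (ψ ω : ℝ → ℝ) (u v : ℝ → ℂ) (t τ : ℝ) : ℂ :=
  (ω (Function.invFun ψ (ψ t - ψ τ)) : ℂ) * u (Function.invFun ψ (ψ t - ψ τ)) *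
    v τ * ((ω τ * deriv ψ τ : ℝ) : ℂ)

/-- The weighted convolution: the ordinary convolution on `ℝ` conjugated by
`u ↦ (ω u) ∘ ψ⁻¹`. -/
def weightedConv (ψ ω : ℝ → ℝ) (u v : ℝ → ℂ) (t : ℝ) : ℂ :=
  ((1 / ω t : ℝ) : ℂ) * ∫ τ : ℝ, convIntegrand ψ ω u v t τ

/-- The Green's function `ω(t)⁻¹ ψ(t)^{α-1} E_{α,α}(-lam ψ(t)^α) Θ(ψ(t))`. -/
def greenFunction (ψ ω : ℝ → ℝ) (α lam : ℝ) (t : ℝ) : ℂ :=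
  ((if 0 < ψ t then
      1 / ω t * (ψ t) ^ (α - 1) * mittagLeffler α α (-lam * (ψ t) ^ α)
    else 0 : ℝ) : ℂ)

end WeightedWeyl

end

/-!
Composition with `ψ⁻¹` and multiplication by `ω`, that is `u ↦ (ω u) ∘ ψ⁻¹` (`transport`), turns
`L¹_{ψ,ω}`, the weighted Fourier transform, the convolution and the Weyl integral into the ordinary
ones on `ℝ`, and the Green's function into the resolvent kernel
`k(s) = s ^ (α - 1) * E_{α,α}(-lam * s ^ α)` on `s > 0`. Everything then follows from two facts
about `k`.

* *Resolvent equation* (`kernelConv_fracKernel_resolventKernel`). With `H` the Heaviside function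
  and `g(s) = s ^ (-α) / Γ(1 - α)` on `s > 0`, one has `g * k = H - lam • (H * k)`. This is the Beta
  integral, applied term by term to the Mittag-Leffler series.
* *Positivity* (`resolventKernel_nonneg`): `k ≥ 0`, by a maximum principle for the fractional
  derivative. With the resolvent equation it gives `lam * ∫ k ≤ 1`, so that `k` is integrable, and
  it bounds the convolutions `g * k` and `H * k`. Bounded convolution of two kernels is all that
  Fubini's theorem needs in order to reassociate them with an integrable function at every point,
  although neither `g` nor `H` is integrable (`BoundedConv.kernelConv_assoc`).

*Existence.* For integrable `F`, associativity gives
`g * (k * F) = H * F - lam • (H * (k * F))`, so the fractional integral of `k * F` is everywhere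
equal to the primitive of `F - lam • (k * F)`; hence it is absolutely continuous and can be
differentiated almost everywhere.

*Uniqueness.* The fundamental theorem of calculus turns the equation into
`g * S = c + H * (F - lam • S)` with an unknown constant `c`. Convolving with `k` and using the
resolvent equation leaves `H * S = c * ∫ k + H * (k * F)`. Both primitives vanish at `-∞`, so
`c * ∫ k = 0`, and differentiation gives `S = k * F` almost everywhere.

*Fourier transform.* The Laplace transform of the resolvent equation at real `r > 0` gives
`(∫ exp (-r s) k(s) ds) * (r ^ α + lam) = 1`. The identity extends to `Re z > 0` by analytic
continuation and to the imaginary axis by dominated convergence. Injectivity of the Fourier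
transform on `L¹` reduces to the fact that a finite measure is determined by its characteristic
function.
-/

noncomputable section

namespace WeightedWeyl

/-! ### Mittag-Leffler functions -/

theorem rpow_mul_exp_neg_le_Gamma {R y : ℝ} (hR : 0 < R) (hy : 1 ≤ y) :
    R ^ (y - 1) * Real.exp (-R) ≤ Real.Gamma y := by
  have hy0 : 0 < y := by linarith
  rw [Real.Gamma_eq_integral hy0]
  have hint := Real.GammaIntegral_convergent hy0
  have hsub : Ioi R ⊆ Ioi (0 : ℝ) := Ioi_subset_Ioi hR.le
  calc R ^ (y - 1) * Real.exp (-R) = ∫ x in Ioi R, R ^ (y - 1) * Real.exp (-x) := by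
        rw [integral_const_mul, integral_exp_neg_Ioi]
    _ ≤ ∫ x in Ioi R, Real.exp (-x) * x ^ (y - 1) := by
        refine setIntegral_mono_on ((integrableOn_exp_neg_Ioi R).const_mul _)
          (hint.mono_set hsub) measurableSet_Ioi fun x hx => ?_
        rw [mul_comm]
        have : R ^ (y - 1) ≤ x ^ (y - 1) :=
          Real.rpow_le_rpow hR.le (le_of_lt hx) (by linarith)
        gcongr
    _ ≤ _ := by
        refine setIntegral_mono_set hint ?_ hsub.eventuallyLE
        filter_upwards [ae_restrict_mem measurableSet_Ioi] with x hx
        have : (0 : ℝ) < x := hx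
        show 0 ≤ Real.exp (-x) * x ^ (y - 1)
        positivity

/-- Since `Γ(y) ≥ R ^ (y - 1) * exp (-R)` for every `R`, the Mittag-Leffler series is dominated by
a geometric series at every argument. -/
theorem summable_mittagLeffler {α : ℝ} (hα : 0 < α) (β x : ℝ) :
    Summable fun k : ℕ => x ^ k / Real.Gamma (α * k + β) := by
  set R : ℝ := (2 * |x| + 1) ^ (1 / α) with hRdef
  have hb : 0 < 2 * |x| + 1 := by positivity
  have hR : 0 < R := Real.rpow_pos_of_pos hb _
  have hRα : R ^ α = 2 * |x| + 1 := by
    rw [hRdef, ← Real.rpow_mul hb.le, one_div_mul_cancel hα.ne', Real.rpow_one]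
  have hgeo : Summable fun k : ℕ =>
      (R ^ (β - 1) * Real.exp (-R))⁻¹ * (|x| / (2 * |x| + 1)) ^ k := by
    refine (summable_geometric_of_lt_one (by positivity) ?_).mul_left _
    rw [div_lt_one hb]
    linarith [abs_nonneg x]
  refine Summable.of_norm_bounded_eventually_nat hgeo ?_
  have hlarge : ∀ᶠ k : ℕ in atTop, 1 ≤ α * k + β := by
    have : Tendsto (fun k : ℕ => α * k + β) atTop atTop :=
      tendsto_atTop_add_const_right _ _ (tendsto_natCast_atTop_atTop.const_mul_atTop hα)
    exact this.eventually_ge_atTop 1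
  filter_upwards [hlarge] with k hk
  have h1 := rpow_mul_exp_neg_le_Gamma hR hk
  have h2 : R ^ (α * k + β - 1) = (2 * |x| + 1) ^ k * R ^ (β - 1) := by
    rw [add_sub_assoc, Real.rpow_add hR, Real.rpow_mul hR.le, hRα, Real.rpow_natCast]
  rw [h2] at h1
  have hpos : 0 < R ^ (β - 1) := Real.rpow_pos_of_pos hR _
  rw [norm_div, norm_pow, Real.norm_eq_abs,
    Real.norm_of_nonneg (Real.Gamma_pos_of_pos (by linarith)).le]
  calc |x| ^ k / Real.Gamma (α * k + β)
      ≤ |x| ^ k / ((2 * |x| + 1) ^ k * R ^ (β - 1) * Real.exp (-R)) := by gcongr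
    _ = _ := by rw [div_pow]; field_simp

theorem differentiable_mittagLeffler {α β : ℝ} (hα : 0 < α) (hβ : 0 < β) :
    Differentiable ℝ (mittagLeffler α β) := by
  set c : ℕ → ℝ := fun k => (Real.Gamma (α * k + β))⁻¹ with hc
  set p := FormalMultilinearSeries.ofScalars ℝ c with hp
  have hrad : p.radius = ⊤ := by
    refine p.radius_eq_top_of_summable_norm fun r => ?_
    refine (summable_mittagLeffler hα β (r : ℝ)).congr fun k => ?_
    rw [hp, FormalMultilinearSeries.ofScalars_norm, hc, div_eq_mul_inv, mul_comm,
      Real.norm_of_nonneg]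
    exact inv_nonneg.2 (Real.Gamma_pos_of_pos (by positivity)).le
  have hsum : mittagLeffler α β = p.sum := by
    funext x
    show _ = FormalMultilinearSeries.ofScalarsSum c x
    rw [FormalMultilinearSeries.ofScalars_sum_eq]
    refine tsum_congr fun k => ?_
    simp [hc, div_eq_inv_mul]
  have hball := p.hasFPowerSeriesOnBall (by rw [hrad]; simp)
  rw [hsum]
  intro x
  exact (hball.differentiableOn.differentiableAt (by
    rw [hrad]; simp))

theorem mittagLeffler_zero (α β : ℝ) : mittagLeffler α β 0 = (Real.Gamma β)⁻¹ := by
  rw [mittagLeffler, tsum_eq_single 0]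
  · simp
  · intro k hk; simp [hk]

theorem mittagLeffler_one_eq {α : ℝ} (hα : 0 < α) (x : ℝ) :
    mittagLeffler α 1 x = 1 + x * mittagLeffler α (α + 1) x := by
  rw [mittagLeffler, (summable_mittagLeffler hα 1 x).tsum_eq_zero_add, mittagLeffler,
    ← tsum_mul_left]
  congr 1
  · simp
  · refine tsum_congr fun k => ?_
    push_cast
    rw [pow_succ, show α * (k + 1 : ℝ) + 1 = α * k + (α + 1) by ring]
    ring

theorem integrableOn_beta {a b s : ℝ} (ha : 0 < a) (hb : 0 < b) (hs : 0 < s) :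
    IntegrableOn (fun τ : ℝ => (s - τ) ^ (b - 1) * τ ^ (a - 1)) (Ioc 0 s) := by
  have hs2 : 0 < s / 2 := by linarith
  have h1 : IntervalIntegrable (fun τ : ℝ => (s - τ) ^ (b - 1) * τ ^ (a - 1)) volume 0 (s / 2) := by
    refine (intervalIntegral.intervalIntegrable_rpow' (by linarith)).continuousOn_mul ?_
    refine ContinuousOn.rpow_const (by fun_prop) fun τ hτ => Or.inl ?_
    rw [uIcc_of_le hs2.le] at hτ
    linarith [hτ.2]
  have h2 : IntervalIntegrable (fun τ : ℝ => (s - τ) ^ (b - 1) * τ ^ (a - 1)) volume (s / 2) s := by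
    have h3 : IntervalIntegrable (fun τ : ℝ => (s - τ) ^ (b - 1)) volume (s / 2) s := by
      have := (intervalIntegral.intervalIntegrable_rpow' (a := s / 2) (b := 0) (r := b - 1)
        (by linarith)).comp_sub_left s
      simpa [show s - s / 2 = s / 2 by ring] using this
    refine h3.mul_continuousOn ?_
    refine ContinuousOn.rpow_const (by fun_prop) fun τ hτ => Or.inl ?_
    rw [uIcc_of_le (by linarith)] at hτ
    linarith [hτ.1]
  exact (intervalIntegrable_iff_integrableOn_Ioc_of_le hs.le).1 (h1.trans h2)

theorem integral_beta {a b s : ℝ} (ha : 0 < a) (hb : 0 < b) (hs : 0 < s) :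
    ∫ τ in Ioc 0 s, (s - τ) ^ (b - 1) * τ ^ (a - 1) =
      s ^ (a + b - 1) * (Real.Gamma a * Real.Gamma b / Real.Gamma (a + b)) := by
  have h := Complex.betaIntegral_scaled a b hs
  rw [Complex.betaIntegral_eq_Gamma_mul_div _ _ (by simpa) (by simpa),
    intervalIntegral.integral_of_le hs.le] at h
  apply Complex.ofReal_injective
  rw [← integral_complex_ofReal]
  push_cast [Complex.ofReal_cpow hs.le, ← Complex.Gamma_ofReal]
  rw [← h]
  refine setIntegral_congr_fun measurableSet_Ioc fun τ hτ => ?_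
  have h1 : 0 ≤ s - τ := by linarith [hτ.2]
  simp only [Complex.ofReal_cpow h1, Complex.ofReal_cpow hτ.1.le]
  push_cast
  ring

/-! ### The resolvent kernel -/

/-- The resolvent kernel `s ^ (α - 1) * E_{α,α}(-lam * s ^ α)`: the Green's function for `ψ = id`,
`ω = 1`, on the half-line `s > 0`. -/
def resolventKernel (α lam s : ℝ) : ℝ := s ^ (α - 1) * mittagLeffler α α (-lam * s ^ α)

variable {α lam : ℝ}

theorem continuous_mittagLeffler_rpow (hα : 0 < α) :
    Continuous fun τ : ℝ => mittagLeffler α α (-lam * τ ^ α) :=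
  (differentiable_mittagLeffler hα hα).continuous.comp
    ((Real.continuous_rpow_const hα.le).const_mul _)

theorem differentiableAt_resolventKernel (hα : 0 < α) {s : ℝ} (hs : 0 < s) :
    DifferentiableAt ℝ (resolventKernel α lam) s := by
  have h1 : ∀ r : ℝ, DifferentiableAt ℝ (fun s : ℝ => s ^ r) s := fun r =>
    (Real.hasDerivAt_rpow_const (Or.inl hs.ne')).differentiableAt
  refine (h1 (α - 1)).mul ?_
  exact (differentiable_mittagLeffler hα hα _).comp s ((h1 α).const_mul (-lam))

theorem integrableOn_weyl_resolventKernel (hα : 0 < α) {b s : ℝ} (hb : 0 < b) (hs : 0 < s) :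
    IntegrableOn (fun τ => (s - τ) ^ (b - 1) * resolventKernel α lam τ) (Ioc 0 s) := by
  have hcont := continuous_mittagLeffler_rpow (lam := lam) hα
  have hI := (intervalIntegrable_iff_integrableOn_Ioc_of_le hs.le).2 (integrableOn_beta hα hb hs)
  refine ((intervalIntegrable_iff_integrableOn_Ioc_of_le hs.le).1
    (hI.mul_continuousOn hcont.continuousOn)).congr_fun (fun τ _ => ?_) measurableSet_Ioc
  simp only [resolventKernel]
  ring

/-- Termwise integration of the Mittag-Leffler series against a power, by the Beta integral. -/
theorem integral_weyl_resolventKernel (hα : 0 < α) {b s : ℝ} (hb : 0 < b) (hs : 0 < s) :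
    ∫ τ in Ioc 0 s, (s - τ) ^ (b - 1) * resolventKernel α lam τ =
      Real.Gamma b * s ^ (α + b - 1) * mittagLeffler α (α + b) (-lam * s ^ α) := by
  set F : ℕ → ℝ → ℝ := fun k τ => (-lam) ^ k / Real.Gamma (α * k + α) *
    ((s - τ) ^ (b - 1) * τ ^ (α * k + α - 1)) with hF
  have hpos : ∀ k : ℕ, 0 < α * k + α := fun k => by positivity
  have hΓ : ∀ k : ℕ, 0 < Real.Gamma (α * k + α) := fun k => Real.Gamma_pos_of_pos (hpos k)
  have hint : ∀ k, Integrable (F k) (volume.restrict (Ioc 0 s)) := fun k =>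
    (integrableOn_beta (hpos k) hb hs).const_mul _
  have hpow : ∀ k : ℕ, s ^ (α * k + α + b - 1) = s ^ (α + b - 1) * (s ^ α) ^ k := fun k => by
    rw [show α * k + α + b - 1 = (α + b - 1) + α * k by ring, Real.rpow_add hs,
      Real.rpow_mul hs.le, Real.rpow_natCast]
  have hval : ∀ (c : ℝ) (k : ℕ), ∫ τ in Ioc 0 s, c ^ k / Real.Gamma (α * k + α) *
      ((s - τ) ^ (b - 1) * τ ^ (α * k + α - 1)) = Real.Gamma b * s ^ (α + b - 1) *
        ((c * s ^ α) ^ k / Real.Gamma (α * k + (α + b))) := fun c k => by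
    rw [integral_const_mul, integral_beta (hpos k) hb hs, hpow, mul_pow,
      show α * (k : ℝ) + (α + b) = α * k + α + b by ring]
    have := (hΓ k).ne'
    field_simp
  have hnorm : ∀ k, ∫ τ in Ioc 0 s, ‖F k τ‖ = Real.Gamma b * s ^ (α + b - 1) *
      ((|lam| * s ^ α) ^ k / Real.Gamma (α * k + (α + b))) := fun k => by
    rw [← hval]
    refine setIntegral_congr_fun measurableSet_Ioc fun τ hτ => ?_
    have h1 : 0 ≤ s - τ := by linarith [hτ.2]
    have h2 : 0 < τ := hτ.1
    simp only [hF]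
    rw [norm_mul, norm_div, norm_pow, norm_neg, Real.norm_eq_abs, Real.norm_of_nonneg (hΓ k).le,
      Real.norm_of_nonneg (by positivity)]
  have hsum := hasSum_integral_of_summable_integral_norm hint (by
    simp only [hnorm]
    exact (summable_mittagLeffler hα _ _).mul_left _)
  have h1 : ∫ τ in Ioc 0 s, (s - τ) ^ (b - 1) * resolventKernel α lam τ =
      ∫ τ in Ioc 0 s, ∑' k, F k τ := by
    refine setIntegral_congr_fun measurableSet_Ioc fun τ hτ => ?_
    have h2 : 0 < τ := hτ.1
    simp only [resolventKernel, mittagLeffler, hF]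
    rw [← tsum_mul_left, ← tsum_mul_left]
    refine tsum_congr fun k => ?_
    rw [show α * (k : ℝ) + α - 1 = (α - 1) + α * k by ring, Real.rpow_add h2,
      Real.rpow_mul h2.le, Real.rpow_natCast, mul_pow]
    ring
  rw [h1, ← hsum.tsum_eq, mittagLeffler, ← tsum_mul_left]
  exact tsum_congr fun k => hval _ k

theorem integrableOn_resolventKernel (hα : 0 < α) {s : ℝ} (hs : 0 < s) :
    IntegrableOn (resolventKernel α lam) (Ioc 0 s) := by
  simpa using integrableOn_weyl_resolventKernel (lam := lam) hα one_pos hs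

/-- The fractional integral of order `1 - α` of the resolvent kernel is one minus `lam` times its
primitive; this encodes the resolvent equation. -/
theorem integral_weyl_resolventKernel_eq (hα : α ∈ Ioo (0 : ℝ) 1) {s : ℝ} (hs : 0 < s) :
    ∫ τ in Ioc 0 s, (s - τ) ^ (-α) * resolventKernel α lam τ =
      Real.Gamma (1 - α) * (1 - lam * ∫ τ in Ioc 0 s, resolventKernel α lam τ) := by
  have h1 := integral_weyl_resolventKernel (lam := lam) hα.1 (b := 1 - α) (by linarith [hα.2]) hs
  have h2 := integral_weyl_resolventKernel (lam := lam) hα.1 one_pos hs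
  simp only [sub_self, Real.rpow_zero, one_mul, Real.Gamma_one, add_sub_cancel_right] at h2
  rw [show 1 - α - 1 = -α by ring, show α + (1 - α) - 1 = 0 by ring, Real.rpow_zero,
    show α + (1 - α) = 1 by ring, mittagLeffler_one_eq hα.1] at h1
  rw [h1, h2]
  ring

/-! ### Positivity and integrability of the resolvent kernel -/

theorem continuousOn_resolventKernel (hα : 0 < α) :
    ContinuousOn (resolventKernel α lam) (Ioi 0) := fun _ hs =>
  (differentiableAt_resolventKernel hα hs).continuousAt.continuousWithinAt

/-- Near the origin the resolvent kernel is positive, being asymptotic to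
`s ^ (α - 1) / Γ(α)`. -/
theorem eventually_resolventKernel_pos (hα : 0 < α) :
    ∀ᶠ s in 𝓝[>] (0 : ℝ), 0 < resolventKernel α lam s := by
  have hcont := continuous_mittagLeffler_rpow (lam := lam) hα
  have h0 : 0 < mittagLeffler α α (-lam * (0 : ℝ) ^ α) := by
    rw [Real.zero_rpow hα.ne', mul_zero, mittagLeffler_zero]
    exact inv_pos.2 (Real.Gamma_pos_of_pos hα)
  have h1 : ∀ᶠ τ : ℝ in 𝓝 0, 0 < mittagLeffler α α (-lam * τ ^ α) :=
    hcont.continuousAt.eventually (lt_mem_nhds h0)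
  filter_upwards [h1.filter_mono nhdsWithin_le_nhds, self_mem_nhdsWithin] with s hs hs0
  exact mul_pos (Real.rpow_pos_of_pos hs0 _) hs

theorem hasDerivAt_integral_resolventKernel (hα : 0 < α) {t : ℝ} (ht : 0 < t) :
    HasDerivAt (fun s => ∫ τ in Ioc 0 s, resolventKernel α lam τ) (resolventKernel α lam t) t := by
  have h := intervalIntegral.integral_hasDerivAt_right
    ((intervalIntegrable_iff_integrableOn_Ioc_of_le ht.le).2
      (integrableOn_resolventKernel (lam := lam) hα ht))
    ((continuousOn_resolventKernel hα).stronglyMeasurableAtFilter isOpen_Ioi t ht)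
    (differentiableAt_resolventKernel hα ht).continuousAt
  refine h.congr_of_eventuallyEq ?_
  filter_upwards [lt_mem_nhds ht] with s hs
  rw [intervalIntegral.integral_of_le hs.le]

/-- Monotonicity of the kernel `x ↦ x ^ (-α)`: when `q ≥ 0` on `(0, t]`, the fractional integral of
`q` increases from `s` to `t` by at most the contribution of `(s, t]`. -/
theorem weyl_sub_le_of_nonneg (hα : 0 < α) {q : ℝ → ℝ} {s t : ℝ} (hs : 0 < s) (hst : s < t)
    (hq : ∀ τ ∈ Ioc 0 t, 0 ≤ q τ)
    (hqs : IntegrableOn (fun τ => (s - τ) ^ (-α) * q τ) (Ioc 0 s))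
    (hqt : IntegrableOn (fun τ => (t - τ) ^ (-α) * q τ) (Ioc 0 t)) :
    (∫ τ in Ioc 0 t, (t - τ) ^ (-α) * q τ) - ∫ τ in Ioc 0 s, (s - τ) ^ (-α) * q τ ≤
      ∫ τ in Ioc s t, (t - τ) ^ (-α) * q τ := by
  have hsplit : Ioc 0 t = Ioc 0 s ∪ Ioc s t := (Ioc_union_Ioc_eq_Ioc hs.le hst.le).symm
  rw [hsplit] at hqt
  rw [hsplit, setIntegral_union (Ioc_disjoint_Ioc_of_le le_rfl) measurableSet_Ioc
    (hqt.mono_set subset_union_left) (hqt.mono_set subset_union_right)]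
  have : ∫ τ in Ioc 0 s, (t - τ) ^ (-α) * q τ ≤ ∫ τ in Ioc 0 s, (s - τ) ^ (-α) * q τ := by
    refine setIntegral_mono_on_ae (hqt.mono_set subset_union_left) hqs measurableSet_Ioc ?_
    -- At `τ = s` the inequality would fail, since `0 ^ (-α) = 0` by convention.
    filter_upwards [compl_mem_ae_iff.2 (measure_singleton s)] with τ hne hτ
    have hτs : τ < s := lt_of_le_of_ne hτ.2 hne
    have h1 : (t - τ) ^ (-α) ≤ (s - τ) ^ (-α) :=
      Real.rpow_le_rpow_of_nonpos (by linarith) (by linarith) (by linarith)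
    exact mul_le_mul_of_nonneg_right h1 (hq τ ⟨hτ.1, by linarith⟩)
  linarith

theorem integral_rpow_sub (hα : α < 1) {s t : ℝ} (hst : s ≤ t) :
    ∫ τ in Ioc s t, (t - τ) ^ (-α) = (t - s) ^ (1 - α) / (1 - α) := by
  rw [← intervalIntegral.integral_of_le hst,
    intervalIntegral.integral_comp_sub_left (fun x : ℝ => x ^ (-α)) t,
    integral_rpow (Or.inl (by linarith)), sub_self, Real.zero_rpow (by linarith)]
  rw [show -α + 1 = 1 - α by ring, sub_zero]

theorem integrableOn_rpow_sub (hα : α < 1) {s t : ℝ} (hst : s ≤ t) :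
    IntegrableOn (fun τ => (t - τ) ^ (-α)) (Ioc s t) := by
  rw [← intervalIntegrable_iff_integrableOn_Ioc_of_le hst]
  simpa using (intervalIntegral.intervalIntegrable_rpow' (a := t - s) (b := 0) (r := -α)
        (by linarith)).comp_sub_left t

/-- The resolvent kernel is nonnegative. This is a maximum principle: at a point `t` where the
kernel has a negative minimum over `(0, t]`, its fractional integral `N` of order `1 - α` has
derivative `-lam * Γ(1 - α)` times that minimum, hence positive; but monotonicity of the fractional
kernel gives `N t - N s ≤ C * (t - s) ^ (2 - α)` for `s < t`, which forces `N' t ≤ 0`. -/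
theorem resolventKernel_nonneg (hα : α ∈ Ioo (0 : ℝ) 1) (hlam : 0 < lam) {s : ℝ} (hs : 0 < s) :
    0 ≤ resolventKernel α lam s := by
  by_contra! hneg
  obtain ⟨hα0, hα1⟩ := hα
  set k := resolventKernel α lam with hk
  -- `k` is positive near `0`, so a negative value forces a minimum over `(0, s]` at some `t > 0`.
  obtain ⟨δ, hδ0, hδ⟩ : ∃ δ > 0, ∀ τ ∈ Ioo 0 δ, 0 < k τ :=
    mem_nhdsGT_iff_exists_Ioo_subset.1 (eventually_resolventKernel_pos hα0)
  obtain ⟨d, hd0, hdδ⟩ := exists_between hδ0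
  have hds : d < s := by
    by_contra! h
    exact absurd (hδ s ⟨hs, h.trans_lt hdδ⟩) hneg.not_gt
  obtain ⟨t, ht, hmin⟩ := isCompact_Icc.exists_isMinOn (nonempty_Icc.2 hds.le)
    ((continuousOn_resolventKernel (lam := lam) hα0).mono fun x hx => hd0.trans_le hx.1)
  have hm : k t < 0 := (hmin (right_mem_Icc.2 hds.le)).trans_lt hneg
  have ht0 : 0 < t := hd0.trans_le ht.1
  have hge : ∀ τ ∈ Ioc 0 t, 0 ≤ k τ - k t := fun τ hτ => by
    rcases le_or_gt d τ with h | h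
    · exact sub_nonneg.2 (hmin ⟨h, hτ.2.trans ht.2⟩)
    · linarith [hδ τ ⟨hτ.1, h.trans hdδ⟩]
  -- The resolvent equation gives the derivative of the fractional integral `N` at `t`.
  set N : ℝ → ℝ := fun r => ∫ τ in Ioc 0 r, (r - τ) ^ (-α) * k τ with hN
  have hΓ : 0 < Real.Gamma (1 - α) := Real.Gamma_pos_of_pos (by linarith)
  have hder : HasDerivAt N (-(Real.Gamma (1 - α) * lam * k t)) t := by
    have h1 := (((hasDerivAt_integral_resolventKernel (lam := lam) hα0 ht0).const_mul
      lam).const_sub 1).const_mul (Real.Gamma (1 - α))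
    have h2 : HasDerivAt (fun r => Real.Gamma (1 - α) *
        (1 - lam * ∫ τ in Ioc 0 r, resolventKernel α lam τ))
        (-(Real.Gamma (1 - α) * lam * k t)) t := h1.congr_deriv (by ring)
    refine h2.congr_of_eventuallyEq ?_
    filter_upwards [lt_mem_nhds ht0] with r hr
    exact integral_weyl_resolventKernel_eq ⟨hα0, hα1⟩ hr
  have hpos : 0 < -(Real.Gamma (1 - α) * lam * k t) := by
    have := mul_pos (mul_pos hΓ hlam) (neg_pos.2 hm)
    linarith
  -- Near `t` one has `0 ≤ k τ - k t ≤ C * (t - τ)`; mere continuity of `k` would not suffice, since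
  -- the contribution of `(r, t]` has to be `o(t - r)`.
  obtain ⟨C, hC0, hC⟩ : ∃ C > 0, ∀ᶠ τ in 𝓝 t, ‖k τ - k t‖ ≤ C * ‖τ - t‖ :=
    (differentiableAt_resolventKernel (lam := lam) hα0 ht0).isBigO_sub.exists_pos.imp
      fun C hC => ⟨hC.1, hC.2.bound⟩
  obtain ⟨ε, hε0, hε⟩ := Metric.eventually_nhds_iff.1 hC
  have hbound : ∀ r, 0 < r → t - ε < r → r < t →
      N t - N r ≤ C / (1 - α) * (t - r) ^ (1 - α) * (t - r) := by
    intro r hr0 hrε hrt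
    have hint : ∀ r, 0 < r → IntegrableOn (fun τ => (r - τ) ^ (-α) * k τ) (Ioc 0 r) := by
      intro r hr
      have := integrableOn_weyl_resolventKernel (lam := lam) hα0 (b := 1 - α) (by linarith) hr
      rwa [show 1 - α - 1 = -α by ring] at this
    have hintq : ∀ r, 0 < r → IntegrableOn (fun τ => (r - τ) ^ (-α) * (k τ - k t)) (Ioc 0 r) := by
      intro r hr
      simp only [mul_sub]
      exact (hint r hr).sub ((integrableOn_rpow_sub hα1 hr.le).mul_const _)
    have hNq : ∀ r, 0 < r → N r = (∫ τ in Ioc 0 r, (r - τ) ^ (-α) * (k τ - k t)) +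
        r ^ (1 - α) / (1 - α) * k t := by
      intro r hr
      simp only [mul_sub]
      rw [integral_sub (hint r hr) ((integrableOn_rpow_sub hα1 hr.le).mul_const _),
        integral_mul_const, integral_rpow_sub hα1 hr.le]
      simp [hN]
    have h1 := weyl_sub_le_of_nonneg hα0 hr0 hrt hge (hintq r hr0) (hintq t ht0)
    have h2 : ∫ τ in Ioc r t, (t - τ) ^ (-α) * (k τ - k t) ≤
        ∫ τ in Ioc r t, (t - τ) ^ (-α) * (C * (t - r)) := by
      refine setIntegral_mono_on ((hintq t ht0).mono_set (Ioc_subset_Ioc_left hr0.le))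
        ((integrableOn_rpow_sub hα1 hrt.le).mul_const _) measurableSet_Ioc fun τ hτ => ?_
      have hτt : |τ - t| = t - τ := by rw [abs_sub_comm, abs_of_nonneg]; linarith [hτ.2]
      have h3 := hε (y := τ) (by rw [Real.dist_eq, hτt]; linarith [hτ.1])
      rw [Real.norm_eq_abs, Real.norm_eq_abs, hτt] at h3
      have h4 : k τ - k t ≤ C * (t - r) :=
        (le_abs_self _).trans (h3.trans (by gcongr; exact hτ.1.le))
      exact mul_le_mul_of_nonneg_left h4 (Real.rpow_nonneg (by linarith [hτ.2]) _)
    rw [integral_mul_const, integral_rpow_sub hα1 hrt.le] at h2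
    have h5 : r ^ (1 - α) ≤ t ^ (1 - α) := Real.rpow_le_rpow hr0.le hrt.le (by linarith)
    have h6 : t ^ (1 - α) / (1 - α) * k t ≤ r ^ (1 - α) / (1 - α) * k t :=
      mul_le_mul_of_nonpos_right (by gcongr) hm.le
    rw [hNq t ht0, hNq r hr0]
    calc _ ≤ (t - r) ^ (1 - α) / (1 - α) * (C * (t - r)) := by linarith
      _ = _ := by ring
  -- Let `r → t` from the left in the slope of `N`.
  have hslope := (hasDerivWithinAt_iff_tendsto_slope' (s := Iio t) (by simp)).1
    (hder.hasDerivWithinAt (s := Iio t))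
  have hlim : Tendsto (fun r => C / (1 - α) * (t - r) ^ (1 - α)) (𝓝[<] t) (𝓝 0) := by
    have : Continuous fun r : ℝ => C / (1 - α) * (t - r) ^ (1 - α) :=
      ((Real.continuous_rpow_const (by linarith)).comp (continuous_const.sub continuous_id)).const_mul
        _
    have h := this.tendsto t
    rw [sub_self, Real.zero_rpow (by linarith), mul_zero] at h
    exact h.mono_left nhdsWithin_le_nhds
  refine absurd (le_of_tendsto_of_tendsto hslope hlim ?_) hpos.not_ge
  filter_upwards [self_mem_nhdsWithin, mem_nhdsWithin_of_mem_nhds (lt_mem_nhds ht0),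
    mem_nhdsWithin_of_mem_nhds (lt_mem_nhds (show t - ε < t by linarith))] with r hrt hr0 hrε
  have hrt' : 0 < t - r := sub_pos.2 hrt
  have h := hbound r hr0 hrε hrt
  rw [slope_def_field, ← neg_div_neg_eq, neg_sub, neg_sub, div_le_iff₀ hrt']
  exact h

/-- By the resolvent equation, `1 - lam * ∫ k` is a fractional integral of the nonnegative kernel
`k`. -/
theorem lam_mul_integral_resolventKernel_le (hα : α ∈ Ioo (0 : ℝ) 1) (hlam : 0 < lam) {s : ℝ}
    (hs : 0 < s) : lam * ∫ τ in Ioc 0 s, resolventKernel α lam τ ≤ 1 := by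
  have h := integral_weyl_resolventKernel_eq (lam := lam) hα hs
  have h0 : 0 ≤ ∫ τ in Ioc 0 s, (s - τ) ^ (-α) * resolventKernel α lam τ :=
    setIntegral_nonneg measurableSet_Ioc fun τ hτ =>
      mul_nonneg (Real.rpow_nonneg (by linarith [hτ.2]) _) (resolventKernel_nonneg hα hlam hτ.1)
  rw [h] at h0
  have := nonneg_of_mul_nonneg_right h0 (Real.Gamma_pos_of_pos (by linarith [hα.2]))
  linarith

theorem integrableOn_Ioi_resolventKernel (hα : α ∈ Ioo (0 : ℝ) 1) (hlam : 0 < lam) :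
    IntegrableOn (resolventKernel α lam) (Ioi 0) := by
  refine integrableOn_Ioi_of_intervalIntegral_norm_bounded (1 / lam) 0 (b := fun n : ℕ => (n : ℝ))
    (l := atTop) (fun n => ?_) tendsto_natCast_atTop_atTop ?_
  · rcases Nat.eq_zero_or_pos n with rfl | hn
    · simp
    · exact integrableOn_resolventKernel hα.1 (by exact_mod_cast hn)
  · filter_upwards [eventually_gt_atTop 0] with n hn
    have hn' : (0 : ℝ) < n := by exact_mod_cast hn
    rw [intervalIntegral.integral_of_le hn'.le, le_div_iff₀' hlam]
    refine le_trans (le_of_eq ?_) (lam_mul_integral_resolventKernel_le hα hlam hn')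
    congr 1
    exact setIntegral_congr_fun measurableSet_Ioc fun τ hτ =>
      Real.norm_of_nonneg (resolventKernel_nonneg hα hlam hτ.1)

/-! ### Convolution with causal kernels -/

/-- The convolution `∫ A(s - τ) F(τ) dτ` of a kernel `A` with a function `F`, which is zero by
convention where the integral does not converge absolutely. -/
def kernelConv (A F : ℝ → ℂ) (s : ℝ) : ℂ := ∫ τ, A (s - τ) * F τ

theorem kernelConv_congr_ae {A F G : ℝ → ℂ} (h : F =ᵐ[volume] G) :
    kernelConv A F = kernelConv A G := by
  funext s
  refine integral_congr_ae ?_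
  filter_upwards [h] with τ hτ
  rw [hτ]

theorem kernelConv_eq_convolution (A F : ℝ → ℂ) :
    kernelConv A F = convolution F A (ContinuousLinearMap.mul ℝ ℂ) volume := by
  funext s
  refine integral_congr_ae (Eventually.of_forall fun τ => ?_)
  simp [mul_comm]

theorem integrable_kernelConv {A F : ℝ → ℂ} (hA : Integrable A) (hF : Integrable F) :
    Integrable (kernelConv A F) := by
  rw [kernelConv_eq_convolution]
  exact hF.integrable_convolution _ hA

theorem ae_integrable_kernelConv {A F : ℝ → ℂ} (hA : Integrable A) (hF : Integrable F) :
    ∀ᵐ s, Integrable fun τ => A (s - τ) * F τ := by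
  filter_upwards [hF.ae_convolution_exists (ContinuousLinearMap.mul ℝ ℂ) hA] with s hs
  refine hs.congr (Eventually.of_forall fun τ => ?_)
  simp [mul_comm]

theorem integral_kernelConv {A F : ℝ → ℂ} (hA : Integrable A) (hF : Integrable F) :
    ∫ s, kernelConv A F s = (∫ s, A s) * ∫ s, F s := by
  rw [kernelConv_eq_convolution, integral_convolution _ hF hA, mul_comm]
  rfl

theorem kernelConv_comm (A F : ℝ → ℂ) : kernelConv A F = kernelConv F A := by
  funext s
  rw [kernelConv, ← integral_sub_left_eq_self _ _ s]
  refine integral_congr_ae (Eventually.of_forall fun τ => ?_)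
  simp [mul_comm]

/-- The convolution of the kernels `A` and `B` converges absolutely at every point, and the
convolution of their absolute values is bounded. Neither kernel needs to be integrable. -/
def BoundedConv (A B : ℝ → ℂ) : Prop :=
  (∀ s, Integrable fun r => A (s - r) * B r) ∧ ∃ C, ∀ s, ∫ r, ‖A (s - r) * B r‖ ≤ C

theorem BoundedConv.symm {A B : ℝ → ℂ} (h : BoundedConv A B) : BoundedConv B A := by
  obtain ⟨h1, C, hC⟩ := h
  refine ⟨fun s => ?_, C, fun s => ?_⟩
  · refine ((h1 s).comp_sub_left s).congr (Eventually.of_forall fun r => ?_)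
    simp [mul_comm]
  · rw [← integral_sub_left_eq_self _ _ s]
    refine le_trans (le_of_eq (integral_congr_ae (Eventually.of_forall fun r => ?_))) (hC s)
    simp [mul_comm]

section Fubini

variable {A B F : ℝ → ℂ}

/-- Absolute convergence of the triple convolution at every point, by Tonelli's theorem. -/
theorem BoundedConv.integrable_prod (hAB : BoundedConv A B) (hA : Measurable A)
    (hB : Measurable B) (hF : Integrable F) (s : ℝ) :
    Integrable (fun p : ℝ × ℝ => A (s - p.1) * (B (p.1 - p.2) * F p.2))
      (volume.prod volume) := by
  obtain ⟨h1, C, hC⟩ := hAB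
  have hmeas : AEStronglyMeasurable (fun p : ℝ × ℝ => A (s - p.1) * (B (p.1 - p.2) * F p.2))
      (volume.prod volume) := by
    refine AEStronglyMeasurable.mul ?_ (AEStronglyMeasurable.mul ?_ ?_)
    · exact (hA.comp (measurable_const.sub measurable_fst)).aestronglyMeasurable
    · exact (hB.comp (measurable_fst.sub measurable_snd)).aestronglyMeasurable
    · exact hF.aestronglyMeasurable.comp_snd
  have hshift : ∀ τ, Integrable fun r => A (s - r) * B (r - τ) := fun τ => by
    refine ((h1 (s - τ)).comp_sub_right τ).congr (Eventually.of_forall fun r => ?_)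
    simp
  rw [integrable_prod_iff' hmeas]
  refine ⟨Eventually.of_forall fun τ => ?_, ?_⟩
  · refine ((hshift τ).mul_const (F τ)).congr (Eventually.of_forall fun r => ?_)
    simp [mul_assoc]
  · refine (hF.norm.const_mul C).mono' hmeas.norm.prod_swap.integral_prod_right' ?_
    refine Eventually.of_forall fun τ => ?_
    rw [Real.norm_of_nonneg (integral_nonneg fun r => norm_nonneg _)]
    have h2 : ∫ r, ‖A (s - r) * (B (r - τ) * F τ)‖ =
        (∫ r, ‖A (s - τ - r) * B r‖) * ‖F τ‖ := by
      rw [← integral_mul_const,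
        ← integral_sub_right_eq_self (fun r => ‖A (s - τ - r) * B r‖ * ‖F τ‖) τ]
      refine integral_congr_ae (Eventually.of_forall fun r => ?_)
      simp [mul_assoc]
    exact h2.trans_le (mul_le_mul_of_nonneg_right (hC _) (norm_nonneg _))

theorem BoundedConv.integrable_left (hAB : BoundedConv A B) (hA : Measurable A)
    (hB : Measurable B) (hF : Integrable F) (s : ℝ) :
    Integrable fun r => A (s - r) * kernelConv B F r := by
  refine (hAB.integrable_prod hA hB hF s).integral_prod_left.congr
    (Eventually.of_forall fun r => ?_)
  exact integral_const_mul (A (s - r)) fun τ => B (r - τ) * F τ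

theorem integral_kernel_mul_shift (s τ : ℝ) :
    ∫ r, A (s - r) * (B (r - τ) * F τ) = kernelConv A B (s - τ) * F τ := by
  rw [kernelConv, ← integral_mul_const,
    ← integral_sub_right_eq_self (fun r => A (s - τ - r) * B r * F τ) τ]
  refine integral_congr_ae (Eventually.of_forall fun r => ?_)
  simp [mul_assoc]

theorem BoundedConv.integrable_right (hAB : BoundedConv A B) (hA : Measurable A)
    (hB : Measurable B) (hF : Integrable F) (s : ℝ) :
    Integrable fun τ => kernelConv A B (s - τ) * F τ := by
  refine (hAB.integrable_prod hA hB hF s).integral_prod_right.congr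
    (Eventually.of_forall fun τ => ?_)
  exact integral_kernel_mul_shift s τ

theorem BoundedConv.kernelConv_assoc (hAB : BoundedConv A B) (hA : Measurable A)
    (hB : Measurable B) (hF : Integrable F) (s : ℝ) :
    kernelConv A (kernelConv B F) s = kernelConv (kernelConv A B) F s := by
  have h := integral_integral_swap (f := fun r τ => A (s - r) * (B (r - τ) * F τ))
    (hAB.integrable_prod hA hB hF s)
  simp only [integral_kernel_mul_shift, integral_const_mul] at h
  exact h

end Fubini

/-- The extension of a kernel on the half-line `s > 0` by zero to `ℝ`. -/
def causal (k : ℝ → ℝ) (s : ℝ) : ℂ := ((if 0 < s then k s else 0 : ℝ) : ℂ)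

theorem causal_of_pos {k : ℝ → ℝ} {s : ℝ} (hs : 0 < s) : causal k s = k s := by
  simp [causal, hs]

theorem causal_of_nonpos {k : ℝ → ℝ} {s : ℝ} (hs : s ≤ 0) : causal k s = 0 := by
  simp [causal, hs.not_gt]

theorem measurable_causal {k : ℝ → ℝ} (hk : Measurable k) : Measurable (causal k) :=
  Complex.measurable_ofReal.comp
    (Measurable.ite (measurableSet_lt measurable_const measurable_id) hk measurable_const)

theorem causal_eq_indicator (k : ℝ → ℝ) :
    causal k = (Ioi (0 : ℝ)).indicator fun s => (k s : ℂ) := by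
  funext s
  by_cases hs : 0 < s
  · rw [causal_of_pos hs, indicator_of_mem (mem_Ioi.2 hs)]
  · rw [causal_of_nonpos (not_lt.1 hs), indicator_of_notMem (by simpa using hs)]

theorem causal_sub_mul_eq_indicator (k : ℝ → ℝ) (F : ℝ → ℂ) (s : ℝ) :
    (fun τ => causal k (s - τ) * F τ) = (Iio s).indicator fun τ => (k (s - τ) : ℂ) * F τ := by
  funext τ
  by_cases hτ : τ < s
  · rw [causal_of_pos (sub_pos.2 hτ), indicator_of_mem (mem_Iio.2 hτ)]
  · rw [causal_of_nonpos (by linarith), indicator_of_notMem (by simpa using hτ), zero_mul]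

theorem kernelConv_causal (k : ℝ → ℝ) (F : ℝ → ℂ) (s : ℝ) :
    kernelConv (causal k) F s = ∫ τ in Iic s, (k (s - τ) : ℂ) * F τ := by
  rw [kernelConv, causal_sub_mul_eq_indicator, integral_indicator measurableSet_Iio,
    integral_Iic_eq_integral_Iio]

theorem causal_mul_causal_eq_indicator (a b : ℝ → ℝ) (s : ℝ) :
    (fun τ => causal a (s - τ) * causal b τ) =
      (Ioo 0 s).indicator fun τ => ((a (s - τ) * b τ : ℝ) : ℂ) := by
  funext τ
  by_cases h : τ ∈ Ioo 0 s
  · rw [causal_of_pos (sub_pos.2 h.2), causal_of_pos h.1, indicator_of_mem h]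
    push_cast
    rfl
  · rw [indicator_of_notMem h]
    rcases le_or_gt τ 0 with h0 | h0
    · rw [causal_of_nonpos h0, mul_zero]
    · rw [causal_of_nonpos (s := s - τ) (by by_contra! h1; exact h ⟨h0, by linarith⟩), zero_mul]

theorem kernelConv_causal_causal (a b : ℝ → ℝ) :
    kernelConv (causal a) (causal b) = causal fun s => ∫ τ in Ioc 0 s, a (s - τ) * b τ := by
  funext s
  rw [kernelConv, causal_mul_causal_eq_indicator, integral_indicator measurableSet_Ioo]
  rcases le_or_gt s 0 with hs | hs
  · rw [causal_of_nonpos hs, Ioo_eq_empty (by linarith), setIntegral_empty]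
  · rw [causal_of_pos hs, ← integral_Ioc_eq_integral_Ioo, integral_complex_ofReal]

/-- For nonnegative causal kernels a bound on the convolution itself is enough. -/
theorem boundedConv_causal {a b : ℝ → ℝ} {C : ℝ} (ha : ∀ s, 0 < s → 0 ≤ a s)
    (hb : ∀ s, 0 < s → 0 ≤ b s)
    (hint : ∀ s, 0 < s → IntegrableOn (fun τ => a (s - τ) * b τ) (Ioc 0 s))
    (hC : 0 ≤ C) (hle : ∀ s, 0 < s → ∫ τ in Ioc 0 s, a (s - τ) * b τ ≤ C) :
    BoundedConv (causal a) (causal b) := by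
  refine ⟨fun s => ?_, C, fun s => ?_⟩
  · rw [causal_mul_causal_eq_indicator, integrable_indicator_iff measurableSet_Ioo]
    rcases le_or_gt s 0 with hs | hs
    · rw [Ioo_eq_empty (by linarith)]
      exact integrableOn_empty
    · exact ((hint s hs).mono_set Ioo_subset_Ioc_self).ofReal
  · have h1 : (fun r => ‖causal a (s - r) * causal b r‖) =
        (Ioo 0 s).indicator fun τ => ‖((a (s - τ) * b τ : ℝ) : ℂ)‖ := by
      funext r
      rw [congr_fun (causal_mul_causal_eq_indicator a b s) r, norm_indicator_eq_indicator_norm]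
    rw [h1, integral_indicator measurableSet_Ioo]
    rcases le_or_gt s 0 with hs | hs
    · rwa [Ioo_eq_empty (by linarith), setIntegral_empty]
    · refine le_trans (le_of_eq ?_) (hle s hs)
      rw [integral_Ioc_eq_integral_Ioo]
      refine setIntegral_congr_fun measurableSet_Ioo fun τ hτ => ?_
      rw [Complex.norm_real, Real.norm_of_nonneg]
      exact mul_nonneg (ha _ (sub_pos.2 hτ.2)) (hb _ hτ.1)

/-! ### The resolvent equation and the equation on the line -/

/-- The kernel of the fractional integral of order `1 - α`. -/
def fracKernel (α s : ℝ) : ℝ := s ^ (-α) / Real.Gamma (1 - α)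

theorem measurable_fracKernel : Measurable (fracKernel α) :=
  (measurable_id.pow_const (-α)).div_const _

theorem measurable_resolventKernel (hα : 0 < α) : Measurable (resolventKernel α lam) := by
  have hcont := continuous_mittagLeffler_rpow (lam := lam) hα
  exact (measurable_id.pow_const (α - 1)).mul hcont.measurable

theorem integrable_causal_resolventKernel (hα : α ∈ Ioo (0 : ℝ) 1) (hlam : 0 < lam) :
    Integrable (causal (resolventKernel α lam)) := by
  rw [causal_eq_indicator, integrable_indicator_iff measurableSet_Ioi]
  exact (integrableOn_Ioi_resolventKernel hα hlam).ofReal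

theorem fracKernel_mul_resolventKernel (s τ : ℝ) :
    fracKernel α (s - τ) * resolventKernel α lam τ =
      (Real.Gamma (1 - α))⁻¹ * ((s - τ) ^ (-α) * resolventKernel α lam τ) := by
  rw [fracKernel]
  ring

theorem integral_fracKernel_mul_resolventKernel (hα : α ∈ Ioo (0 : ℝ) 1) {s : ℝ} (hs : 0 < s) :
    ∫ τ in Ioc 0 s, fracKernel α (s - τ) * resolventKernel α lam τ =
      1 - lam * ∫ τ in Ioc 0 s, resolventKernel α lam τ := by
  simp only [fracKernel_mul_resolventKernel]
  rw [integral_const_mul, integral_weyl_resolventKernel_eq hα hs, inv_mul_cancel_left₀]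
  exact (Real.Gamma_pos_of_pos (by linarith [hα.2])).ne'

theorem boundedConv_fracKernel (hα : α ∈ Ioo (0 : ℝ) 1) (hlam : 0 < lam) :
    BoundedConv (causal (fracKernel α)) (causal (resolventKernel α lam)) := by
  have hΓ : 0 < Real.Gamma (1 - α) := Real.Gamma_pos_of_pos (by linarith [hα.2])
  refine boundedConv_causal (C := 1) (fun s hs => ?_)
    (fun s hs => resolventKernel_nonneg hα hlam hs)
    (fun s hs => ?_) zero_le_one fun s hs => ?_
  · rw [fracKernel]; positivity
  · simp only [fracKernel_mul_resolventKernel]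
    have h := integrableOn_weyl_resolventKernel (lam := lam) hα.1 (b := 1 - α)
      (by linarith [hα.2]) hs
    rw [show 1 - α - 1 = -α by ring] at h
    exact h.const_mul _
  · rw [integral_fracKernel_mul_resolventKernel hα hs]
    have : 0 ≤ lam * ∫ τ in Ioc 0 s, resolventKernel α lam τ :=
      mul_nonneg hlam.le (setIntegral_nonneg measurableSet_Ioc fun τ hτ =>
        resolventKernel_nonneg hα hlam hτ.1)
    linarith

theorem boundedConv_one (hα : α ∈ Ioo (0 : ℝ) 1) (hlam : 0 < lam) :
    BoundedConv (causal fun _ => 1) (causal (resolventKernel α lam)) := by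
  refine boundedConv_causal (C := 1 / lam) (fun s _ => zero_le_one)
    (fun s hs => resolventKernel_nonneg hα hlam hs)
    (fun s hs => ?_) (by positivity) fun s hs => ?_
  · simpa using integrableOn_resolventKernel hα.1 hs
  · rw [le_div_iff₀' hlam]
    simpa using lam_mul_integral_resolventKernel_le hα hlam hs

/-- The resolvent equation: convolving the resolvent kernel with the kernel of the fractional
integral of order `1 - α` gives the Heaviside function minus `lam` times the primitive of the
resolvent kernel. -/
theorem kernelConv_fracKernel_resolventKernel (hα : α ∈ Ioo (0 : ℝ) 1) :
    kernelConv (causal (fracKernel α)) (causal (resolventKernel α lam)) = fun s =>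
      causal (fun _ => 1) s -
        lam * kernelConv (causal fun _ => 1) (causal (resolventKernel α lam)) s := by
  rw [kernelConv_causal_causal, kernelConv_causal_causal]
  funext s
  rcases le_or_gt s 0 with hs | hs
  · simp [causal_of_nonpos hs]
  · simp only [causal_of_pos hs, integral_fracKernel_mul_resolventKernel hα hs, one_mul]
    push_cast
    rfl

theorem kernelConv_one (F : ℝ → ℂ) (s : ℝ) :
    kernelConv (causal fun _ => 1) F s = ∫ τ in Iic s, F τ := by
  rw [kernelConv_causal]
  simp

theorem integrable_one_mul {F : ℝ → ℂ} (hF : Integrable F) (s : ℝ) :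
    Integrable fun τ => causal (fun _ => 1) (s - τ) * F τ := by
  rw [causal_sub_mul_eq_indicator, integrable_indicator_iff measurableSet_Iio]
  simpa using hF.integrableOn

theorem kernelConv_kernelConv_fracKernel_eq {F : ℝ → ℂ} (hα : α ∈ Ioo (0 : ℝ) 1) (hlam : 0 < lam)
    (hF : Integrable F) (s : ℝ) :
    kernelConv (kernelConv (causal (fracKernel α)) (causal (resolventKernel α lam))) F s =
      (∫ τ in Iic s, F τ) - lam * ∫ τ in Iic s, kernelConv (causal (resolventKernel α lam)) F τ := by
  have hK : Measurable (causal (resolventKernel α lam)) :=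
    measurable_causal (measurable_resolventKernel hα.1)
  have hH : Measurable (causal fun _ => 1) := measurable_causal measurable_const
  have hb := boundedConv_one (lam := lam) hα hlam
  rw [kernelConv_fracKernel_resolventKernel hα, ← kernelConv_one, ← kernelConv_one,
    hb.kernelConv_assoc hH hK hF]
  rw [kernelConv, kernelConv, kernelConv, ← integral_const_mul,
    ← integral_sub (integrable_one_mul hF s) ((hb.integrable_right hH hK hF s).const_mul _)]
  refine integral_congr_ae (Eventually.of_forall fun τ => ?_)
  simp only
  ring

/-- Convolution with the resolvent kernel solves the equation, integrated once. -/
theorem fracKernel_kernelConv_eq {F : ℝ → ℂ} (hα : α ∈ Ioo (0 : ℝ) 1) (hlam : 0 < lam)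
    (hF : Integrable F) (s : ℝ) :
    kernelConv (causal (fracKernel α)) (kernelConv (causal (resolventKernel α lam)) F) s =
      ∫ τ in Iic s, (F τ - lam * kernelConv (causal (resolventKernel α lam)) F τ) := by
  rw [(boundedConv_fracKernel hα hlam).kernelConv_assoc (measurable_causal measurable_fracKernel)
    (measurable_causal (measurable_resolventKernel hα.1)) hF,
    kernelConv_kernelConv_fracKernel_eq hα hlam hF,
    integral_sub hF.integrableOn, integral_const_mul]
  exact ((integrable_kernelConv (integrable_causal_resolventKernel hα hlam) hF).const_mul
    _).integrableOn

theorem ae_eq_of_forall_integral_Iic_eq {F G : ℝ → ℂ} (hF : Integrable F) (hG : Integrable G)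
    (h : ∀ s, ∫ τ in Iic s, F τ = ∫ τ in Iic s, G τ) : F =ᵐ[volume] G := by
  have hi : ∀ s, ∫ τ in (0 : ℝ)..s, F τ = ∫ τ in (0 : ℝ)..s, G τ := fun s => by
    rw [← intervalIntegral.integral_Iic_sub_Iic hF.integrableOn hF.integrableOn,
      ← intervalIntegral.integral_Iic_sub_Iic hG.integrableOn hG.integrableOn, h, h]
  filter_upwards [LocallyIntegrable.ae_hasDerivAt_integral hF.locallyIntegrable,
    LocallyIntegrable.ae_hasDerivAt_integral hG.locallyIntegrable] with s hs hs'
  have h1 := hs 0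
  simp only [hi] at h1
  exact h1.unique (hs' 0)

/-- Uniqueness for the integrated equation. The constant of integration is not prescribed: after
convolution with the resolvent kernel, letting `s` tend to `-∞` shows that it contributes
nothing. -/
theorem ae_eq_kernelConv_resolventKernel {F S : ℝ → ℂ} {c : ℂ} (hα : α ∈ Ioo (0 : ℝ) 1)
    (hlam : 0 < lam) (hF : Integrable F) (hS : Integrable S)
    (h : ∀ᵐ s, kernelConv (causal (fracKernel α)) S s = c + ∫ τ in Iic s, (F τ - lam * S τ)) :
    S =ᵐ[volume] kernelConv (causal (resolventKernel α lam)) F := by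
  set K := causal (resolventKernel α lam) with hKdef
  have hKi : Integrable K := integrable_causal_resolventKernel hα hlam
  have hK : Measurable K := measurable_causal (measurable_resolventKernel hα.1)
  have hH : Measurable (causal fun _ => 1) := measurable_causal measurable_const
  have hg : Measurable (causal (fracKernel α)) := measurable_causal measurable_fracKernel
  have hb := boundedConv_one (lam := lam) hα hlam
  have hcomm : ∀ {G : ℝ → ℂ}, Integrable G → ∀ s,
      kernelConv K (kernelConv (causal fun _ => 1) G) s = ∫ τ in Iic s, kernelConv K G τ := by
    intro G hG s
    rw [hb.symm.kernelConv_assoc hK hH hG, kernelConv_comm K, ← hb.kernelConv_assoc hH hK hG,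
      kernelConv_one]
  have hFS : Integrable fun τ => F τ - lam * S τ := hF.sub (hS.const_mul _)
  have key : ∀ s, ∫ τ in Iic s, S τ = (∫ r, K r) * c + ∫ τ in Iic s, kernelConv K F τ := by
    intro s
    have h1 := kernelConv_kernelConv_fracKernel_eq (lam := lam) hα hlam hS s
    rw [kernelConv_comm (causal (fracKernel α)), ← (boundedConv_fracKernel hα
      hlam).symm.kernelConv_assoc hK hg hS, kernelConv_congr_ae (G := fun s => c +
      kernelConv (causal fun _ => 1) (fun τ => F τ - lam * S τ) s)
      (by simpa only [kernelConv_one, EventuallyEq] using h)] at h1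
    have h2 : kernelConv K (fun s => c +
        kernelConv (causal fun _ => 1) (fun τ => F τ - lam * S τ) s) s =
        (∫ r, K r) * c + ∫ τ in Iic s, kernelConv K (fun τ => F τ - lam * S τ) τ := by
      rw [← hcomm hFS, kernelConv]
      simp only [mul_add]
      rw [integral_add ((hKi.comp_sub_left s).mul_const c) (hb.symm.integrable_left hK hH hFS s),
        integral_mul_const, integral_sub_left_eq_self]
      rfl
    have h3 : ∫ τ in Iic s, kernelConv K (fun τ => F τ - lam * S τ) τ =
        (∫ τ in Iic s, kernelConv K F τ) - lam * ∫ τ in Iic s, kernelConv K S τ := by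
      rw [← integral_const_mul, ← integral_sub (integrable_kernelConv hKi hF).integrableOn
        ((integrable_kernelConv hKi hS).const_mul _).integrableOn]
      refine integral_congr_ae (ae_restrict_of_ae ?_)
      filter_upwards [ae_integrable_kernelConv hKi hF, ae_integrable_kernelConv hKi hS]
        with τ h4 h5
      simp only [kernelConv]
      rw [← integral_const_mul, ← integral_sub h4 (h5.const_mul _)]
      refine integral_congr_ae (Eventually.of_forall fun r => ?_)
      simp only
      ring
    rw [h2, h3] at h1
    linear_combination -h1
  have hc : (∫ r, K r) * c = 0 := by
    have h1 : Tendsto (fun s => ∫ τ in Iic s, S τ) atBot (𝓝 0) :=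
      tendsto_integral_Iic_zero tendsto_id
    have h2 : Tendsto (fun s => (∫ r, K r) * c + ∫ τ in Iic s, kernelConv K F τ) atBot
        (𝓝 ((∫ r, K r) * c + 0)) := (tendsto_integral_Iic_zero tendsto_id).const_add _
    simp only [key, add_zero] at h1 h2
    exact tendsto_nhds_unique h2 h1
  refine ae_eq_of_forall_integral_Iic_eq hS (integrable_kernelConv hKi hF) fun s => ?_
  rw [key, hc, zero_add]

/-! ### Laplace and Fourier transform of the resolvent kernel -/

/-- Multiplication of a function by `exp (-(r * s))`. -/
def expWeight (r : ℝ) (A : ℝ → ℂ) (s : ℝ) : ℂ := (Real.exp (-(r * s)) : ℂ) * A s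

theorem kernelConv_expWeight (r : ℝ) (A B : ℝ → ℂ) :
    kernelConv (expWeight r A) (expWeight r B) = expWeight r (kernelConv A B) := by
  funext s
  rw [kernelConv, expWeight, kernelConv, ← integral_const_mul]
  refine integral_congr_ae (Eventually.of_forall fun τ => ?_)
  have : Real.exp (-(r * s)) = Real.exp (-(r * (s - τ))) * Real.exp (-(r * τ)) := by
    rw [← Real.exp_add]
    ring_nf
  simp only [expWeight]
  rw [this]
  push_cast
  ring

theorem expWeight_causal (r : ℝ) (k : ℝ → ℝ) :
    expWeight r (causal k) = causal fun s => Real.exp (-(r * s)) * k s := by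
  funext s
  rw [expWeight, causal, causal]
  split_ifs <;> simp

theorem integrable_expWeight_causal {r : ℝ} (hr : 0 ≤ r) {k : ℝ → ℝ}
    (hk : Integrable (causal k)) : Integrable (expWeight r (causal k)) := by
  refine hk.norm.mono' ?_ (Eventually.of_forall fun s => ?_)
  · exact (by fun_prop : Continuous fun s : ℝ => (Real.exp (-(r * s)) : ℂ)).aestronglyMeasurable.mul
      hk.aestronglyMeasurable
  · rw [expWeight, norm_mul, Complex.norm_real, Real.norm_of_nonneg (Real.exp_pos _).le]
    rcases le_or_gt s 0 with hs | hs
    · simp [causal_of_nonpos hs]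
    · exact mul_le_of_le_one_left (norm_nonneg _)
        (Real.exp_le_one_iff.2 (neg_nonpos.2 (mul_nonneg hr hs.le)))

theorem integrable_expWeight_rpow {a r : ℝ} (ha : 0 < a) (hr : 0 < r) :
    Integrable (expWeight r (causal fun s => s ^ (a - 1))) := by
  rw [expWeight_causal, causal_eq_indicator, integrable_indicator_iff measurableSet_Ioi]
  refine Integrable.ofReal ?_
  have h := integrableOn_rpow_mul_exp_neg_mul_rpow (s := a - 1) (by linarith) one_pos hr
  refine h.congr_fun (fun s _ => ?_) measurableSet_Ioi
  simp only [Real.rpow_one, neg_mul]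
  exact mul_comm _ _

theorem integral_expWeight_rpow {a r : ℝ} (ha : 0 < a) (hr : 0 < r) :
    ∫ s, expWeight r (causal fun s => s ^ (a - 1)) s = ((1 / r) ^ a * Real.Gamma a : ℝ) := by
  rw [expWeight_causal, causal_eq_indicator, integral_indicator measurableSet_Ioi,
    integral_complex_ofReal, ← Real.integral_rpow_mul_exp_neg_mul_Ioi ha hr]
  simp only [mul_comm]

/-- The Laplace transform of the resolvent kernel at a positive real number, from the resolvent
equation and the multiplicativity of the Laplace transform. -/
theorem integral_expWeight_resolventKernel (hα : α ∈ Ioo (0 : ℝ) 1) (hlam : 0 < lam) {r : ℝ}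
    (hr : 0 < r) :
    (∫ s, expWeight r (causal (resolventKernel α lam)) s) * ((r ^ α + lam : ℝ) : ℂ) = 1 := by
  set K := causal (resolventKernel α lam) with hKdef
  have hKi : Integrable (expWeight r K) :=
    integrable_expWeight_causal hr.le (integrable_causal_resolventKernel hα hlam)
  have hΓ : Real.Gamma (1 - α) ≠ 0 := (Real.Gamma_pos_of_pos (by linarith [hα.2])).ne'
  have hg : expWeight r (causal (fracKernel α)) = fun s => ((Real.Gamma (1 - α))⁻¹ : ℂ) *
      expWeight r (causal fun s => s ^ (1 - α - 1)) s := by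
    funext s
    rw [expWeight, expWeight, causal, causal]
    simp only [fracKernel, show 1 - α - 1 = -α by ring]
    split_ifs
    · push_cast
      ring
    · simp
  have hgi : Integrable (expWeight r (causal (fracKernel α))) := by
    rw [hg]
    exact (integrable_expWeight_rpow (by linarith [hα.2]) hr).const_mul _
  have hgv : ∫ s, expWeight r (causal (fracKernel α)) s = ((1 / r) ^ (1 - α) : ℝ) := by
    rw [hg, integral_const_mul, integral_expWeight_rpow (by linarith [hα.2]) hr]
    push_cast
    rw [mul_comm, mul_assoc, mul_inv_cancel₀ (by exact_mod_cast hΓ), mul_one]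
  have hHi : Integrable (expWeight r (causal fun _ => 1)) := by
    simpa using integrable_expWeight_rpow one_pos hr
  have hHv : ∫ s, expWeight r (causal fun _ => 1) s = ((1 / r : ℝ) : ℂ) := by
    simpa using integral_expWeight_rpow one_pos hr
  have h1 := integral_kernelConv hgi hKi
  have h2 := integral_kernelConv hHi hKi
  have hHK := integrable_kernelConv hHi hKi
  rw [kernelConv_expWeight] at h2 hHK
  rw [kernelConv_expWeight, kernelConv_fracKernel_resolventKernel hα] at h1
  have h3 : ∫ s, expWeight r (fun s => causal (fun _ => 1) s -
      lam * kernelConv (causal fun _ => 1) K s) s = (∫ s, expWeight r (causal fun _ => 1) s) -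
        lam * ∫ s, expWeight r (kernelConv (causal fun _ => 1) K) s := by
    rw [← integral_const_mul, ← integral_sub hHi (hHK.const_mul _)]
    refine integral_congr_ae (Eventually.of_forall fun s => ?_)
    simp only [expWeight]
    ring
  rw [h3, h2, hgv, hHv] at h1
  have hr' : (r : ℂ) ≠ 0 := by exact_mod_cast hr.ne'
  have h4 : ((r ^ α : ℝ) : ℂ) = r * ((1 / r) ^ (1 - α) : ℝ) := by
    rw [one_div, Real.inv_rpow hr.le, ← Real.rpow_neg hr.le]
    nth_rewrite 2 [← Real.rpow_one r]
    rw [← Complex.ofReal_mul, ← Real.rpow_add hr]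
    ring_nf
  have h5 : (r : ℂ) * ((1 / r : ℝ) : ℂ) = 1 := by
    push_cast
    field_simp
  rw [Complex.ofReal_add, h4]
  linear_combination -(r : ℂ) * h1 + (1 - lam * ∫ s, expWeight r K s) * h5

/-- The Laplace transform of the resolvent kernel on the right half-plane, by analytic continuation
from the positive real axis. -/
theorem laplace_resolventKernel (hα : α ∈ Ioo (0 : ℝ) 1) (hlam : 0 < lam) {z : ℂ} (hz : 0 < z.re) :
    (∫ s : ℝ, Complex.exp (-(z * s)) * causal (resolventKernel α lam) s) *
      (z ^ (α : ℂ) + lam) = 1 := by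
  set k : ℝ → ℝ := fun s => if 0 < s then resolventKernel α lam s else 0 with hk
  have hk0 : ∀ s, 0 ≤ k s := fun s => by
    simp only [hk]
    split_ifs with hs
    · exact resolventKernel_nonneg hα hlam hs
    · exact le_rfl
  have hkm : Measurable k := Measurable.ite (measurableSet_lt measurable_const measurable_id)
    (measurable_resolventKernel hα.1) measurable_const
  set μ : Measure ℝ := volume.withDensity fun s => ENNReal.ofReal (k s) with hμ
  have hint : ∀ g : ℝ → ℂ, ∫ s, g s ∂μ = ∫ s, g s * causal (resolventKernel α lam) s := fun g => by
    rw [hμ, integral_withDensity_eq_integral_toReal_smul hkm.ennreal_ofReal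
      (Eventually.of_forall fun s => ENNReal.ofReal_lt_top)]
    refine integral_congr_ae (Eventually.of_forall fun s => ?_)
    simp only [ENNReal.toReal_ofReal (hk0 s), Complex.real_smul, mul_comm]
    rfl
  have hset : Ioi (0 : ℝ) ⊆ interior (ProbabilityTheory.integrableExpSet (fun s : ℝ => -s) μ) := by
    refine interior_maximal (fun r hr => ?_) isOpen_Ioi
    have h1 := (integrable_expWeight_causal (le_of_lt hr)
      (integrable_causal_resolventKernel hα hlam)).re
    show Integrable _ _
    rw [hμ, integrable_withDensity_iff_integrable_smul' hkm.ennreal_ofReal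
      (Eventually.of_forall fun s => ENNReal.ofReal_lt_top)]
    refine h1.congr (Eventually.of_forall fun s => ?_)
    simp only [ENNReal.toReal_ofReal (hk0 s), expWeight, causal, ← Complex.ofReal_mul]
    rw [RCLike.re_eq_complex_re, Complex.ofReal_re, smul_eq_mul, mul_comm, mul_neg]
  have hM : ∀ w : ℂ, ProbabilityTheory.complexMGF (fun s : ℝ => -s) μ w =
      ∫ s : ℝ, Complex.exp (-(w * s)) * causal (resolventKernel α lam) s := fun w => by
    rw [ProbabilityTheory.complexMGF, hint]
    simp
  have han : AnalyticOnNhd ℂ (fun w => ProbabilityTheory.complexMGF (fun s : ℝ => -s) μ w *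
      (w ^ (α : ℂ) + lam)) {w | 0 < w.re} := by
    refine AnalyticOnNhd.mul (ProbabilityTheory.analyticOnNhd_complexMGF.mono fun w hw => hset hw) ?_
    refine AnalyticOnNhd.add (fun w hw => ?_) analyticOnNhd_const
    exact analyticAt_id.cpow analyticAt_const (Or.inl hw)
  have hfreq : ∃ᶠ w in 𝓝[≠] (1 : ℂ), ProbabilityTheory.complexMGF (fun s : ℝ => -s) μ w *
      (w ^ (α : ℂ) + lam) = 1 := by
    have hreal : ∀ r : ℝ, 0 < r → ProbabilityTheory.complexMGF (fun s : ℝ => -s) μ r *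
        ((r : ℂ) ^ (α : ℂ) + lam) = 1 := fun r hr => by
      have h := integral_expWeight_resolventKernel hα hlam hr
      rw [Complex.ofReal_add, Complex.ofReal_cpow hr.le] at h
      rw [hM, ← h]
      simp only [expWeight]
      push_cast
      rfl
    have ht : Tendsto (fun r : ℝ => (r : ℂ)) (𝓝[≠] 1) (𝓝[≠] (1 : ℂ)) := by
      refine tendsto_nhdsWithin_iff.2 ⟨?_, ?_⟩
      · exact (Complex.continuous_ofReal.tendsto' (1 : ℝ) 1 (by simp)).mono_left nhdsWithin_le_nhds
      · filter_upwards [self_mem_nhdsWithin] with r hr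
        simpa using hr
    refine ht.frequently (Eventually.frequently ?_)
    filter_upwards [mem_nhdsWithin_of_mem_nhds (lt_mem_nhds one_pos)] with r hr
    exact hreal r hr
  have hpre : IsPreconnected {w : ℂ | 0 < w.re} := (convex_halfSpace_re_gt 0).isPreconnected
  have h := han.eqOn_of_preconnected_of_frequently_eq (g := fun _ => 1) analyticOnNhd_const hpre
    (by simp : (1 : ℂ) ∈ {w : ℂ | 0 < w.re}) hfreq hz
  simp only [hM] at h
  exact h

/-- The Fourier transform of the resolvent kernel, as the boundary value of its Laplace
transform. -/
theorem fourier_resolventKernel (hα : α ∈ Ioo (0 : ℝ) 1) (hlam : 0 < lam) (ξ : ℝ) :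
    ∫ s : ℝ, Complex.exp (-(Complex.I * ξ * s)) * causal (resolventKernel α lam) s =
      ((Complex.I * ξ) ^ (α : ℂ) + lam)⁻¹ := by
  refine eq_inv_of_mul_eq_one_left ?_
  have hKi := integrable_causal_resolventKernel hα hlam
  have hz : Tendsto (fun ε : ℝ => (ε : ℂ) + Complex.I * ξ) (𝓝[>] 0) (𝓝 (Complex.I * ξ)) :=
    (Continuous.tendsto' (by fun_prop) 0 _ (by simp)).mono_left nhdsWithin_le_nhds
  have h1 : Tendsto (fun ε : ℝ => ((ε : ℂ) + Complex.I * ξ) ^ (α : ℂ) + lam) (𝓝[>] 0)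
      (𝓝 ((Complex.I * ξ) ^ (α : ℂ) + lam)) := by
    have h0 : ContinuousAt (fun w : ℂ => w ^ (α : ℂ)) (Complex.I * ξ) :=
      Complex.continuousAt_cpow_const_of_re_pos (Or.inl (by simp)) (by simpa using hα.1)
    exact (h0.tendsto.comp hz).add_const _
  have h2 : Tendsto (fun ε : ℝ => ∫ s : ℝ, Complex.exp (-(((ε : ℂ) + Complex.I * ξ) * s)) *
      causal (resolventKernel α lam) s) (𝓝[>] 0)
      (𝓝 (∫ s : ℝ, Complex.exp (-(Complex.I * ξ * s)) * causal (resolventKernel α lam) s)) := by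
    refine tendsto_integral_filter_of_dominated_convergence _
      (Eventually.of_forall fun ε => ?_) ?_ hKi.norm (Eventually.of_forall fun s => ?_)
    · exact (by fun_prop : Continuous fun s : ℝ => Complex.exp (-(((ε : ℂ) + Complex.I * ξ) *
        s))).aestronglyMeasurable.mul hKi.aestronglyMeasurable
    · filter_upwards [self_mem_nhdsWithin] with ε hε
      refine Eventually.of_forall fun s => ?_
      rcases le_or_gt s 0 with hs | hs
      · simp [causal_of_nonpos hs]
      · rw [norm_mul, Complex.norm_exp]
        refine mul_le_of_le_one_left (norm_nonneg _) (Real.exp_le_one_iff.2 ?_)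
        simpa using (mul_pos (mem_Ioi.1 hε) hs).le
    · refine Tendsto.mul_const _ ?_
      exact (Complex.continuous_exp.tendsto _).comp ((hz.mul_const _).neg)
  refine tendsto_nhds_unique ((h2.mul h1).congr' ?_) tendsto_const_nhds
  filter_upwards [self_mem_nhdsWithin] with ε hε
  exact laplace_resolventKernel hα hlam (by simpa using hε)

/-! ### Injectivity of the Fourier transform -/

/-- A real integrable function with vanishing Fourier transform is zero: its positive and negative
parts are densities of finite measures with the same characteristic function. -/
theorem ae_eq_zero_of_fourier_eq_zero_real {U : ℝ → ℝ} (hU : Integrable U)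
    (h : ∀ ξ : ℝ, ∫ s : ℝ, Complex.exp (ξ * s * Complex.I) * (U s : ℂ) = 0) : U =ᵐ[volume] 0 := by
  have hfin : ∀ V : ℝ → ℝ, Integrable V →
      IsFiniteMeasure (volume.withDensity fun s => ENNReal.ofReal (V s)) := fun V hV =>
    isFiniteMeasure_withDensity_ofReal hV.2
  have hchar : ∀ V : ℝ → ℝ, Integrable V → ∀ ξ : ℝ,
      charFun (volume.withDensity fun s => ENNReal.ofReal (V s)) ξ =
        ∫ s : ℝ, Complex.exp (ξ * s * Complex.I) * ((max (V s) 0 : ℝ) : ℂ) := fun V hV ξ => by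
    rw [charFun_apply_real, integral_withDensity_eq_integral_toReal_smul₀
      hV.aestronglyMeasurable.aemeasurable.ennreal_ofReal
      (Eventually.of_forall fun s => ENNReal.ofReal_lt_top)]
    refine integral_congr_ae (Eventually.of_forall fun s => ?_)
    simp only [ENNReal.toReal_ofReal', Complex.real_smul, mul_comm]
  have hexp : ∀ V : ℝ → ℝ, Integrable V → ∀ ξ : ℝ,
      Integrable fun s : ℝ => Complex.exp (ξ * s * Complex.I) * ((max (V s) 0 : ℝ) : ℂ) :=
    fun V hV ξ => by
      refine hV.pos_part.ofReal.bdd_mul (c := 1)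
        (by fun_prop : Continuous fun s : ℝ => Complex.exp (ξ * s * Complex.I)).aestronglyMeasurable
        (Eventually.of_forall fun s => ?_)
      rw [← Complex.ofReal_mul, Complex.norm_exp_ofReal_mul_I]
  have hUn : Integrable fun s => -U s := hU.neg
  have h1 := hfin U hU
  have h2 := hfin _ hUn
  have heq : (volume.withDensity fun s => ENNReal.ofReal (U s)) =
      volume.withDensity fun s => ENNReal.ofReal (-U s) := by
    refine Measure.ext_of_charFun (funext fun ξ => ?_)
    rw [hchar U hU, hchar _ hUn, ← sub_eq_zero,
      ← integral_sub (hexp U hU ξ) (hexp _ hUn ξ), ← h ξ]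
    refine integral_congr_ae (Eventually.of_forall fun s => ?_)
    simp only
    rw [← mul_sub, ← Complex.ofReal_sub, max_zero_sub_max_neg_zero_eq_self]
  rw [withDensity_eq_iff_of_sigmaFinite hU.aestronglyMeasurable.aemeasurable.ennreal_ofReal
    hUn.aestronglyMeasurable.aemeasurable.ennreal_ofReal] at heq
  filter_upwards [heq] with s hs
  rcases le_total 0 (U s) with hs0 | hs0
  · rw [ENNReal.ofReal_of_nonpos (neg_nonpos.2 hs0), ENNReal.ofReal_eq_zero] at hs
    exact le_antisymm hs hs0
  · rw [ENNReal.ofReal_of_nonpos hs0, eq_comm, ENNReal.ofReal_eq_zero] at hs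
    exact le_antisymm hs0 (neg_nonpos.1 hs)

/-- Injectivity of the Fourier transform on complex integrable functions. -/
theorem ae_eq_of_fourier_eq {U V : ℝ → ℂ} (hU : Integrable U) (hV : Integrable V)
    (h : ∀ ξ : ℝ, ∫ s : ℝ, Complex.exp (-(Complex.I * ξ * s)) * U s =
      ∫ s : ℝ, Complex.exp (-(Complex.I * ξ * s)) * V s) : U =ᵐ[volume] V := by
  set W : ℝ → ℂ := fun s => U s - V s with hWdef
  have hW : Integrable W := hU.sub hV
  have hexp : ∀ X : ℝ → ℂ, Integrable X → ∀ ξ : ℝ,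
      Integrable fun s : ℝ => Complex.exp (ξ * s * Complex.I) * X s := fun X hX ξ => by
    refine hX.bdd_mul (c := 1)
      (by fun_prop : Continuous fun s : ℝ => Complex.exp (ξ * s * Complex.I)).aestronglyMeasurable
      (Eventually.of_forall fun s => ?_)
    rw [← Complex.ofReal_mul, Complex.norm_exp_ofReal_mul_I]
  have h0 : ∀ ξ : ℝ, ∫ s : ℝ, Complex.exp (ξ * s * Complex.I) * W s = 0 := fun ξ => by
    simp only [hWdef, mul_sub]
    rw [integral_sub (hexp U hU ξ) (hexp V hV ξ), sub_eq_zero]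
    have := h (-ξ)
    push_cast at this
    have harg : ∀ s : ℝ, -(Complex.I * -(ξ : ℂ) * s) = ξ * s * Complex.I := fun s => by ring
    simpa only [harg] using this
  have hconj : ∀ ξ : ℝ, ∫ s : ℝ, Complex.exp (ξ * s * Complex.I) * (starRingEnd ℂ) (W s) = 0 :=
    fun ξ => by
      have h1 := congrArg (starRingEnd ℂ) (h0 (-ξ))
      rw [← integral_conj, map_zero] at h1
      rw [← h1]
      refine integral_congr_ae (Eventually.of_forall fun s => ?_)
      simp [← Complex.exp_conj]
  have hWc : Integrable fun s => (starRingEnd ℂ) (W s) :=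
    (Complex.conjLIE.toContinuousLinearEquiv : ℂ →L[ℝ] ℂ).integrable_comp hW
  have hre := ae_eq_zero_of_fourier_eq_zero_real hW.re fun ξ => by
    have h1 := (integral_add (hexp W hW ξ) (hexp _ hWc ξ)).trans
      (by rw [h0, hconj, add_zero] : _ = (0 : ℂ))
    have h2 : ∫ s : ℝ, Complex.exp (ξ * s * Complex.I) * ((W s).re : ℂ) =
        2⁻¹ * ∫ s : ℝ, (Complex.exp (ξ * s * Complex.I) * W s +
          Complex.exp (ξ * s * Complex.I) * (starRingEnd ℂ) (W s)) := by
      rw [← integral_const_mul]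
      refine integral_congr_ae (Eventually.of_forall fun s => ?_)
      simp only [Complex.re_eq_add_conj]
      ring
    exact h2.trans (by rw [h1, mul_zero])
  have him := ae_eq_zero_of_fourier_eq_zero_real hW.im fun ξ => by
    have h1 := (integral_sub (hexp W hW ξ) (hexp _ hWc ξ)).trans
      (by rw [h0, hconj, sub_zero] : _ = (0 : ℂ))
    have h2 : ∫ s : ℝ, Complex.exp (ξ * s * Complex.I) * ((W s).im : ℂ) =
        (2 * Complex.I)⁻¹ * ∫ s : ℝ, (Complex.exp (ξ * s * Complex.I) * W s -
          Complex.exp (ξ * s * Complex.I) * (starRingEnd ℂ) (W s)) := by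
      rw [← integral_const_mul]
      refine integral_congr_ae (Eventually.of_forall fun s => ?_)
      simp only [Complex.im_eq_sub_conj]
      ring
    exact h2.trans (by rw [h1, mul_zero])
  filter_upwards [hre, him] with s h1 h2
  exact sub_eq_zero.1 (Complex.ext h1 h2)

/-! ### Absolutely continuous functions on the line -/

theorem dist_integral_Iic {E : Type*} [NormedAddCommGroup E] [NormedSpace ℝ E] {w : ℝ → E}
    (hw : Integrable w) (x y : ℝ) :
    dist (∫ τ in Iic x, w τ) (∫ τ in Iic y, w τ) = ‖∫ τ in x..y, w τ‖ := by
  rw [dist_comm, dist_eq_norm, intervalIntegral.integral_Iic_sub_Iic hw.integrableOn hw.integrableOn]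

/-- A complex indefinite integral is absolutely continuous, being dominated by the indefinite
integral of the absolute value. -/
theorem absolutelyContinuousOnInterval_integral_Iic {w : ℝ → ℂ} (hw : Integrable w) (a b : ℝ) :
    AbsolutelyContinuousOnInterval (fun t => ∫ τ in Iic t, w τ) a b := by
  have hV := (hw.norm.intervalIntegrable (a := a) (b := b)
    ).absolutelyContinuousOnInterval_intervalIntegral (left_mem_uIcc)
  refine squeeze_zero (fun E => Finset.sum_nonneg fun i _ => dist_nonneg)
    (fun E => Finset.sum_le_sum fun i _ => ?_) hV
  rw [dist_integral_Iic hw, dist_comm, Real.dist_eq,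
    intervalIntegral.integral_interval_sub_left hw.norm.intervalIntegrable
      hw.norm.intervalIntegrable]
  exact intervalIntegral.norm_integral_le_abs_integral_norm

theorem ae_hasDerivAt_integral_Iic {w : ℝ → ℂ} (hw : Integrable w) :
    ∀ᵐ t, HasDerivAt (fun t => ∫ τ in Iic t, w τ) (w t) t := by
  filter_upwards [LocallyIntegrable.ae_hasDerivAt_integral hw.locallyIntegrable] with t ht
  refine ((ht 0).const_add (∫ τ in Iic 0, w τ)).congr_of_eventuallyEq
    (Eventually.of_forall fun x => ?_)
  simp only
  rw [← intervalIntegral.integral_Iic_sub_Iic hw.integrableOn hw.integrableOn, add_sub_cancel]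

theorem ae_differentiableAt_of_absolutelyContinuous {U : ℝ → ℂ}
    (hU : ∀ a b, AbsolutelyContinuousOnInterval U a b) : ∀ᵐ t, DifferentiableAt ℝ U t := by
  have h : ∀ n : ℕ, ∀ᵐ t, t ∈ uIcc (-(n : ℝ)) n → DifferentiableAt ℝ U t := fun n =>
    (hU _ _).boundedVariationOn.ae_differentiableAt_of_mem_uIcc
  filter_upwards [ae_all_iff.2 h] with t ht
  obtain ⟨n, hn⟩ := exists_nat_ge |t|
  refine ht n ?_
  rw [uIcc_of_le (by linarith [abs_nonneg t])]
  exact abs_le.1 hn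

/-- The fundamental theorem of calculus for locally absolutely continuous functions with integrable
derivative on the line. -/
theorem eq_const_add_integral_Iic {U w : ℝ → ℂ} (hw : Integrable w)
    (hU : ∀ a b, AbsolutelyContinuousOnInterval U a b) (hd : ∀ᵐ t, deriv U t = w t) :
    ∃ c, ∀ t, U t = c + ∫ τ in Iic t, w τ := by
  set D : ℝ → ℂ := fun t => U t - ∫ τ in Iic t, w τ with hD
  have hDac : ∀ a b, AbsolutelyContinuousOnInterval D a b := fun a b =>
    (hU a b).sub (absolutelyContinuousOnInterval_integral_Iic hw a b)
  have hD0 : ∀ᵐ t, HasDerivAt D 0 t := by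
    filter_upwards [ae_differentiableAt_of_absolutelyContinuous hU, hd,
      ae_hasDerivAt_integral_Iic hw] with t h1 h2 h3
    have h4 := h1.hasDerivAt.sub h3
    rw [h2, sub_self] at h4
    exact h4
  refine ⟨D 0, fun t => ?_⟩
  obtain ⟨C, hC⟩ := (hDac 0 t).const_of_ae_hasDerivAt_zero (hD0.mono fun x hx _ => hx)
  have h1 : D t = D 0 := (hC t right_mem_uIcc).trans (hC 0 left_mem_uIcc).symm
  rw [← h1, hD]
  simp

/-! ### Change of variables -/

/-- An increasing `C¹`-diffeomorphism of the line onto itself with positive derivative. -/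
structure IsTimeChange (ψ : ℝ → ℝ) : Prop where
  strictMono : StrictMono ψ
  contDiff : ContDiff ℝ 1 ψ
  deriv_pos : ∀ t, 0 < deriv ψ t
  surjective : Function.Surjective ψ

/-- The function `(ω u) ∘ ψ⁻¹`, which carries the weighted notions to those for `ψ = id`,
`ω = 1`. -/
def transport (ψ ω : ℝ → ℝ) (u : ℝ → ℂ) (s : ℝ) : ℂ :=
  (ω (Function.invFun ψ s) : ℂ) * u (Function.invFun ψ s)

/-- The density whose primitive is `ω · I^{1-α} σ` when `σ` solves the equation with right-hand
side `f`. -/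
def residual (ψ ω : ℝ → ℝ) (lam : ℝ) (f σ : ℝ → ℂ) (t : ℝ) : ℂ :=
  ((ω t * deriv ψ t : ℝ) : ℂ) * (f t - lam * σ t)

namespace IsTimeChange

variable {ψ ω : ℝ → ℝ}

theorem invFun_apply (hψ : IsTimeChange ψ) (t : ℝ) : Function.invFun ψ (ψ t) = t :=
  Function.leftInverse_invFun hψ.strictMono.injective t

theorem transport_apply (hψ : IsTimeChange ψ) (u : ℝ → ℂ) (t : ℝ) :
    transport ψ ω u (ψ t) = ω t * u t := by
  rw [transport, hψ.invFun_apply]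

theorem hasDerivAt (hψ : IsTimeChange ψ) (t : ℝ) : HasDerivAt ψ (deriv ψ t) t :=
  (hψ.contDiff.differentiable one_ne_zero t).hasDerivAt

theorem measurable_deriv (hψ : IsTimeChange ψ) : Measurable (deriv ψ) :=
  (hψ.contDiff.continuous_deriv le_rfl).measurable

theorem integrable_comp_iff (hψ : IsTimeChange ψ) (h : ℝ → ℂ) :
    Integrable (fun t => ((deriv ψ t : ℝ) : ℂ) * h (ψ t)) ↔ Integrable h := by
  have h1 := integrableOn_image_iff_integrableOn_abs_deriv_smul (s := univ) MeasurableSet.univ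
    (fun t _ => (hψ.hasDerivAt t).hasDerivWithinAt) hψ.strictMono.injective.injOn h
  rw [image_univ, hψ.surjective.range_eq, integrableOn_univ, integrableOn_univ] at h1
  rw [h1]
  simp only [abs_of_pos (hψ.deriv_pos _), Complex.real_smul]

theorem integral_comp (hψ : IsTimeChange ψ) (h : ℝ → ℂ) :
    ∫ t, ((deriv ψ t : ℝ) : ℂ) * h (ψ t) = ∫ s, h s := by
  have h1 := integral_image_eq_integral_abs_deriv_smul (s := univ) MeasurableSet.univ
    (fun t _ => (hψ.hasDerivAt t).hasDerivWithinAt) hψ.strictMono.injective.injOn h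
  rw [image_univ, hψ.surjective.range_eq, Measure.restrict_univ] at h1
  rw [h1]
  simp only [abs_of_pos (hψ.deriv_pos _), Complex.real_smul]

theorem setIntegral_Iic_comp (hψ : IsTimeChange ψ) (h : ℝ → ℂ) (t : ℝ) :
    ∫ τ in Iic t, ((deriv ψ τ : ℝ) : ℂ) * h (ψ τ) = ∫ s in Iic (ψ t), h s := by
  rw [← integral_indicator measurableSet_Iic, ← integral_indicator measurableSet_Iic,
    ← hψ.integral_comp ((Iic (ψ t)).indicator h)]
  refine integral_congr_ae (Eventually.of_forall fun τ => ?_)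
  by_cases hτ : τ ≤ t
  · simp [indicator, hτ, hψ.strictMono.le_iff_le]
  · simp [indicator, hτ, hψ.strictMono.le_iff_le]

/-- A time change and its inverse preserve null sets. -/
theorem ae_comp_iff (hψ : IsTimeChange ψ) {p : ℝ → Prop} :
    (∀ᵐ t, p (ψ t)) ↔ ∀ᵐ s, p s := by
  have hmap := map_withDensity_abs_det_fderiv_eq_addHaar volume (s := univ) (f := ψ)
    MeasurableSet.univ.nullMeasurableSet
    (fun t _ => (hψ.hasDerivAt t).hasFDerivAt.hasFDerivWithinAt) hψ.strictMono.injective.injOn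
  rw [image_univ, hψ.surjective.range_eq, Measure.restrict_univ] at hmap
  have hemb : MeasurableEmbedding ψ :=
    hψ.contDiff.continuous.measurableEmbedding hψ.strictMono.injective
  have hdet : ∀ t, |(ContinuousLinearMap.toSpanSingleton ℝ (deriv ψ t)).det| = deriv ψ t :=
    fun t => by
      rw [ContinuousLinearMap.det_toSpanSingleton, abs_of_pos (hψ.deriv_pos t)]
  simp only [hdet] at hmap
  nth_rewrite 2 [← hmap]
  rw [hemb.ae_map_iff, ae_withDensity_iff hψ.measurable_deriv.ennreal_ofReal]
  simp [hψ.deriv_pos]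

theorem integrable_weighted_iff (hψ : IsTimeChange ψ) (hω : Measurable ω)
    (hω_pos : ∀ t, 0 < ω t) (u : ℝ → ℂ) :
    Integrable u (weightedMeasure ψ ω) ↔ Integrable (transport ψ ω u) := by
  have hm : Measurable fun t => ω t * deriv ψ t := hω.mul hψ.measurable_deriv
  rw [weightedMeasure, integrable_withDensity_iff_integrable_smul' hm.ennreal_ofReal
    (Eventually.of_forall fun t => ENNReal.ofReal_lt_top),
    ← hψ.integrable_comp_iff (transport ψ ω u)]
  refine integrable_congr (Eventually.of_forall fun t => ?_)
  simp only
  rw [ENNReal.toReal_ofReal (mul_pos (hω_pos t) (hψ.deriv_pos t)).le, hψ.transport_apply,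
    Complex.real_smul]
  push_cast
  ring

/-! ### Weighted operators in the new variable -/

theorem sqrt_mul_weightedFourier (hψ : IsTimeChange ψ) (u : ℝ → ℂ) (ξ : ℝ) :
    (Real.sqrt (2 * Real.pi) : ℂ) * weightedFourier ψ ω u ξ =
      ∫ s : ℝ, Complex.exp (-(Complex.I * ξ * s)) * transport ψ ω u s := by
  have h0 : (Real.sqrt (2 * Real.pi) : ℂ) ≠ 0 := by
    exact_mod_cast (Real.sqrt_pos.2 (by positivity)).ne'
  rw [weightedFourier, ← mul_assoc, ← hψ.integral_comp fun s : ℝ =>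
    Complex.exp (-(Complex.I * ξ * s)) * transport ψ ω u s]
  push_cast
  rw [mul_one_div_cancel h0, one_mul]
  refine integral_congr_ae (Eventually.of_forall fun t => ?_)
  simp only [hψ.transport_apply]
  ring

theorem transport_greenFunction (hψ : IsTimeChange ψ) (hω_pos : ∀ t, 0 < ω t) :
    transport ψ ω (greenFunction ψ ω α lam) = causal (resolventKernel α lam) := by
  funext s
  obtain ⟨t, rfl⟩ := hψ.surjective s
  rw [hψ.transport_apply, greenFunction, causal, ← Complex.ofReal_mul]
  congr 1
  split_ifs
  · rw [resolventKernel]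
    have := (hω_pos t).ne'
    field_simp
  · rw [mul_zero]

theorem convIntegrand_greenFunction (hψ : IsTimeChange ψ) (hω_pos : ∀ t, 0 < ω t) (f : ℝ → ℂ)
    (t τ : ℝ) :
    convIntegrand ψ ω (greenFunction ψ ω α lam) f t τ =
      ((deriv ψ τ : ℝ) : ℂ) *
        (causal (resolventKernel α lam) (ψ t - ψ τ) * transport ψ ω f (ψ τ)) := by
  rw [convIntegrand, ← hψ.transport_greenFunction hω_pos, hψ.transport_apply, transport]
  push_cast
  ring

theorem weightedConv_greenFunction (hψ : IsTimeChange ψ) (hω_pos : ∀ t, 0 < ω t) (f : ℝ → ℂ)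
    (t : ℝ) :
    weightedConv ψ ω (greenFunction ψ ω α lam) f t = ((1 / ω t : ℝ) : ℂ) *
      kernelConv (causal (resolventKernel α lam)) (transport ψ ω f) (ψ t) := by
  simp only [weightedConv, hψ.convIntegrand_greenFunction hω_pos]
  rw [hψ.integral_comp fun s => causal (resolventKernel α lam) (ψ t - s) * transport ψ ω f s,
    kernelConv]

theorem transport_weightedConv (hψ : IsTimeChange ψ) (hω_pos : ∀ t, 0 < ω t) (f : ℝ → ℂ) :
    transport ψ ω (weightedConv ψ ω (greenFunction ψ ω α lam) f) =
      kernelConv (causal (resolventKernel α lam)) (transport ψ ω f) := by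
  funext s
  obtain ⟨t, rfl⟩ := hψ.surjective s
  have : (ω t : ℂ) ≠ 0 := by exact_mod_cast (hω_pos t).ne'
  rw [hψ.transport_apply, hψ.weightedConv_greenFunction hω_pos]
  push_cast
  rw [← mul_assoc, mul_one_div_cancel this, one_mul]

theorem weightedConv_greenFunction_eq_integral (hψ : IsTimeChange ψ) (hω_pos : ∀ t, 0 < ω t)
    (f : ℝ → ℂ) (t : ℝ) :
    weightedConv ψ ω (greenFunction ψ ω α lam) f t = ((1 / ω t : ℝ) : ℂ) * ∫ τ in Iic t,
      (((ψ t - ψ τ) ^ (α - 1) * mittagLeffler α α (-lam * (ψ t - ψ τ) ^ α) : ℝ) : ℂ) *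
        f τ * ((ω τ * deriv ψ τ : ℝ) : ℂ) := by
  rw [hψ.weightedConv_greenFunction hω_pos, kernelConv_causal, ← hψ.setIntegral_Iic_comp]
  congr 1
  refine integral_congr_ae (Eventually.of_forall fun τ => ?_)
  simp only [hψ.transport_apply, resolventKernel]
  push_cast
  ring

theorem weylIntegrand_eq (hψ : IsTimeChange ψ) (hα : α ∈ Ioo (0 : ℝ) 1) (u : ℝ → ℂ) (t τ : ℝ) :
    weylIntegrand ψ ω (1 - α) u t τ = (Real.Gamma (1 - α) : ℂ) * (((deriv ψ τ : ℝ) : ℂ) *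
      ((fracKernel α (ψ t - ψ τ) : ℂ) * transport ψ ω u (ψ τ))) := by
  have hΓ : (Real.Gamma (1 - α) : ℂ) ≠ 0 := by
    exact_mod_cast (Real.Gamma_pos_of_pos (by linarith [hα.2])).ne'
  rw [weylIntegrand, hψ.transport_apply, fracKernel, show 1 - α - 1 = -α by ring]
  push_cast
  field_simp

theorem weylIntegral_eq (hψ : IsTimeChange ψ) (hω_pos : ∀ t, 0 < ω t) (hα : α ∈ Ioo (0 : ℝ) 1)
    (u : ℝ → ℂ) (t : ℝ) :
    (ω t : ℂ) * weylIntegral ψ ω (1 - α) u t =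
      kernelConv (causal (fracKernel α)) (transport ψ ω u) (ψ t) := by
  have hΓ : (Real.Gamma (1 - α) : ℂ) ≠ 0 := by
    exact_mod_cast (Real.Gamma_pos_of_pos (by linarith [hα.2])).ne'
  have hω : (ω t : ℂ) ≠ 0 := by exact_mod_cast (hω_pos t).ne'
  simp only [weylIntegral, hψ.weylIntegrand_eq hα]
  rw [integral_const_mul, hψ.setIntegral_Iic_comp
    fun s => (fracKernel α (ψ t - s) : ℂ) * transport ψ ω u s, kernelConv_causal]
  push_cast
  field_simp

theorem integrableOn_weylIntegrand (hψ : IsTimeChange ψ) (hα : α ∈ Ioo (0 : ℝ) 1) {u : ℝ → ℂ}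
    {t : ℝ} (h : Integrable fun s => causal (fracKernel α) (ψ t - s) * transport ψ ω u s) :
    IntegrableOn (weylIntegrand ψ ω (1 - α) u t) (Iic t) := by
  rw [integrableOn_Iic_iff_integrableOn_Iio, ← integrable_indicator_iff measurableSet_Iio]
  refine (((hψ.integrable_comp_iff _).2 h).const_mul (Real.Gamma (1 - α) : ℂ)).congr
    (Eventually.of_forall fun τ => ?_)
  simp only
  by_cases hτ : τ < t
  · rw [indicator_of_mem (mem_Iio.2 hτ), hψ.weylIntegrand_eq hα,
      causal_of_pos (sub_pos.2 (hψ.strictMono hτ))]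
  · have hle : ψ t ≤ ψ τ := hψ.strictMono.monotone (not_lt.1 hτ)
    rw [indicator_of_notMem (by simpa using hτ), causal_of_nonpos (sub_nonpos.2 hle)]
    simp

theorem residual_eq (hψ : IsTimeChange ψ) (f σ : ℝ → ℂ) (t : ℝ) :
    residual ψ ω lam f σ t = ((deriv ψ t : ℝ) : ℂ) *
      (transport ψ ω f (ψ t) - lam * transport ψ ω σ (ψ t)) := by
  rw [residual, hψ.transport_apply, hψ.transport_apply]
  push_cast
  ring

theorem integrable_residual (hψ : IsTimeChange ψ) {f σ : ℝ → ℂ}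
    (hf : Integrable (transport ψ ω f)) (hσ : Integrable (transport ψ ω σ)) :
    Integrable (residual ψ ω lam f σ) :=
  ((hψ.integrable_comp_iff _).2 (hf.sub (hσ.const_mul (lam : ℂ)))).congr
    (Eventually.of_forall fun t => (hψ.residual_eq f σ t).symm)

theorem integral_residual (hψ : IsTimeChange ψ) (f σ : ℝ → ℂ) (t : ℝ) :
    ∫ τ in Iic t, residual ψ ω lam f σ τ =
      ∫ s in Iic (ψ t), (transport ψ ω f s - lam * transport ψ ω σ s) := by
  simp only [hψ.residual_eq]
  exact hψ.setIntegral_Iic_comp (fun s => transport ψ ω f s - lam * transport ψ ω σ s) t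

/-- The fractional integral of order `1 - α` of the convolution with the Green's function is, at
every point, the primitive of `f - lam * σ` with respect to `ω ψ'`. -/
theorem mul_weylIntegral_weightedConv (hψ : IsTimeChange ψ) (hω_pos : ∀ t, 0 < ω t)
    (hα : α ∈ Ioo (0 : ℝ) 1) (hlam : 0 < lam) {f : ℝ → ℂ} (hf : Integrable (transport ψ ω f))
    (t : ℝ) :
    (ω t : ℂ) * weylIntegral ψ ω (1 - α) (weightedConv ψ ω (greenFunction ψ ω α lam) f) t =
      ∫ τ in Iic t, residual ψ ω lam f (weightedConv ψ ω (greenFunction ψ ω α lam) f) τ := by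
  rw [hψ.weylIntegral_eq hω_pos hα, hψ.integral_residual, hψ.transport_weightedConv hω_pos,
    fracKernel_kernelConv_eq hα hlam hf]

theorem ae_eq_weightedConv_of_isSolution (hψ : IsTimeChange ψ) (hω : Measurable ω)
    (hω_pos : ∀ t, 0 < ω t) (hα : α ∈ Ioo (0 : ℝ) 1) (hlam : 0 < lam) {f σ : ℝ → ℂ}
    (hf : Integrable (transport ψ ω f)) (hσ : IsSolution ψ ω α lam f σ) :
    σ =ᵐ[volume] weightedConv ψ ω (greenFunction ψ ω α lam) f := by
  obtain ⟨hσi, v, ⟨-, U, hUac, hU, hv⟩, heq⟩ := hσ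
  rw [hψ.integrable_weighted_iff hω hω_pos] at hσi
  obtain ⟨c, hc⟩ := eq_const_add_integral_Iic (hψ.integrable_residual (lam := lam) hf hσi) hUac (by
    filter_upwards [hv, heq] with t h1 h2
    rw [residual, ← h2, h1]
    rw [add_sub_cancel_right, ← mul_assoc, ← Complex.ofReal_mul,
      mul_one_div_cancel (mul_pos (hω_pos t) (hψ.deriv_pos t)).ne', Complex.ofReal_one, one_mul])
  have hS : transport ψ ω σ =ᵐ[volume]
      kernelConv (causal (resolventKernel α lam)) (transport ψ ω f) := by
    refine ae_eq_kernelConv_resolventKernel (c := c) hα hlam hf hσi ?_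
    rw [← hψ.ae_comp_iff]
    filter_upwards [hU] with t ht
    rw [← hψ.weylIntegral_eq hω_pos hα, ← ht, hc, hψ.integral_residual]
  rw [← hψ.transport_weightedConv hω_pos] at hS
  filter_upwards [hψ.ae_comp_iff.2 hS] with t ht
  rw [hψ.transport_apply, hψ.transport_apply] at ht
  exact mul_left_cancel₀ (by exact_mod_cast (hω_pos t).ne') ht

end IsTimeChange

end WeightedWeyl

end

theorem theorem4p2 (ψ ω : ℝ → ℝ) (α lam : ℝ)
    (hψ_mono : StrictMono ψ) (hψ_C1 : ContDiff ℝ 1 ψ) (hψ_pos : ∀ t, 0 < deriv ψ t)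
    (hψ_top : Tendsto ψ atTop atTop) (hψ_bot : Tendsto ψ atBot atBot)
    (hω_meas : Measurable ω) (hω_pos : ∀ t, 0 < ω t)
    (hω_loc : ∀ K : Set ℝ, IsCompact K →
      MemLp ω ⊤ (volume.restrict K) ∧ MemLp (fun t => 1 / ω t) ⊤ (volume.restrict K))
    (hα : α ∈ Ioo (0 : ℝ) 1) (hlam : 0 < lam) :
    -- the Green's function is the element of `L¹_{ψ,ω}` with the stated transform
    Integrable (WeightedWeyl.greenFunction ψ ω α lam) (WeightedWeyl.weightedMeasure ψ ω) ∧
    (∀ ξ : ℝ, (Real.sqrt (2 * Real.pi) : ℂ) *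
        WeightedWeyl.weightedFourier ψ ω (WeightedWeyl.greenFunction ψ ω α lam) ξ =
      ((Complex.I * (ξ : ℂ)) ^ (α : ℂ) + (lam : ℂ))⁻¹) ∧
    (∀ u : ℝ → ℂ, Integrable u (WeightedWeyl.weightedMeasure ψ ω) →
      (∀ ξ : ℝ, (Real.sqrt (2 * Real.pi) : ℂ) * WeightedWeyl.weightedFourier ψ ω u ξ =
        ((Complex.I * (ξ : ℂ)) ^ (α : ℂ) + (lam : ℂ))⁻¹) →
      u =ᵐ[volume] WeightedWeyl.greenFunction ψ ω α lam) ∧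
    ∀ f : ℝ → ℂ, Integrable f (WeightedWeyl.weightedMeasure ψ ω) →
      -- the convolution integral converges absolutely almost everywhere
      (∀ᵐ t : ℝ, Integrable (WeightedWeyl.convIntegrand ψ ω
        (WeightedWeyl.greenFunction ψ ω α lam) f t)) ∧
      -- existence, also with the derivative taken literally
      WeightedWeyl.IsSolution ψ ω α lam f
        (WeightedWeyl.weightedConv ψ ω (WeightedWeyl.greenFunction ψ ω α lam) f) ∧
      (∀ a b : ℝ, AbsolutelyContinuousOnInterval (fun s => (ω s : ℂ) *
        WeightedWeyl.weylIntegral ψ ω (1 - α)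
          (WeightedWeyl.weightedConv ψ ω (WeightedWeyl.greenFunction ψ ω α lam) f) s) a b) ∧
      (∀ᵐ t : ℝ,
        WeightedWeyl.weylDeriv ψ ω α
            (WeightedWeyl.weightedConv ψ ω (WeightedWeyl.greenFunction ψ ω α lam) f) t +
          (lam : ℂ) *
            WeightedWeyl.weightedConv ψ ω (WeightedWeyl.greenFunction ψ ω α lam) f t = f t) ∧
      -- uniqueness
      (∀ σ : ℝ → ℂ, WeightedWeyl.IsSolution ψ ω α lam f σ →
        σ =ᵐ[volume]
          WeightedWeyl.weightedConv ψ ω (WeightedWeyl.greenFunction ψ ω α lam) f) ∧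
      -- causality: the solution on `(-∞, T]` depends only on the forcing on `(-∞, T]`
      (∀ (g : ℝ → ℂ) (T : ℝ), Integrable g (WeightedWeyl.weightedMeasure ψ ω) →
        (∀ᵐ t : ℝ, t ≤ T → f t = g t) →
        ∀ t ≤ T,
          WeightedWeyl.weightedConv ψ ω (WeightedWeyl.greenFunction ψ ω α lam) f t =
            WeightedWeyl.weightedConv ψ ω (WeightedWeyl.greenFunction ψ ω α lam) g t) ∧
      -- the explicit formula
      (∀ t : ℝ,
        WeightedWeyl.weightedConv ψ ω (WeightedWeyl.greenFunction ψ ω α lam) f t =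
          ((1 / ω t : ℝ) : ℂ) * ∫ τ in Iic t,
            (((ψ t - ψ τ) ^ (α - 1) *
              WeightedWeyl.mittagLeffler α α (-lam * (ψ t - ψ τ) ^ α) : ℝ) : ℂ) *
              f τ * ((ω τ * deriv ψ τ : ℝ) : ℂ)) := by
  have hψ : WeightedWeyl.IsTimeChange ψ :=
    ⟨hψ_mono, hψ_C1, hψ_pos, hψ_C1.continuous.surjective hψ_top hψ_bot⟩
  have hiff := hψ.integrable_weighted_iff hω_meas hω_pos
  have hKi := WeightedWeyl.integrable_causal_resolventKernel hα hlam
  have hG := hψ.transport_greenFunction (α := α) (lam := lam) hω_pos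
  have hGi : Integrable (WeightedWeyl.greenFunction ψ ω α lam)
      (WeightedWeyl.weightedMeasure ψ ω) := by
    rwa [hiff, hG]
  have hGF : ∀ ξ : ℝ, (Real.sqrt (2 * Real.pi) : ℂ) *
      WeightedWeyl.weightedFourier ψ ω (WeightedWeyl.greenFunction ψ ω α lam) ξ =
      ((Complex.I * (ξ : ℂ)) ^ (α : ℂ) + (lam : ℂ))⁻¹ := fun ξ => by
    rw [hψ.sqrt_mul_weightedFourier, hG, WeightedWeyl.fourier_resolventKernel hα hlam]
  refine ⟨hGi, hGF, fun u hu huF => ?_, fun f hf => ?_⟩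
  · have h := WeightedWeyl.ae_eq_of_fourier_eq ((hiff u).1 hu) ((hiff _).1 hGi) fun ξ => by
      rw [← hψ.sqrt_mul_weightedFourier, ← hψ.sqrt_mul_weightedFourier, huF, hGF]
    filter_upwards [hψ.ae_comp_iff.2 h] with t ht
    rw [hψ.transport_apply, hψ.transport_apply] at ht
    exact mul_left_cancel₀ (by exact_mod_cast (hω_pos t).ne') ht
  rw [hiff] at hf
  set σ := WeightedWeyl.weightedConv ψ ω (WeightedWeyl.greenFunction ψ ω α lam) f with hσ
  have hσT := hψ.transport_weightedConv (α := α) (lam := lam) hω_pos f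
  have hσi : Integrable (WeightedWeyl.transport ψ ω σ) := by
    rw [hσT]
    exact WeightedWeyl.integrable_kernelConv hKi hf
  have hprim := hψ.mul_weylIntegral_weightedConv hω_pos hα hlam hf
  have hprim' : (fun s => (ω s : ℂ) * WeightedWeyl.weylIntegral ψ ω (1 - α) σ s) = fun t =>
      ∫ τ in Iic t, WeightedWeyl.residual ψ ω lam f σ τ := funext hprim
  have hri := hψ.integrable_residual (lam := lam) hf hσi
  have hAC : ∀ a b : ℝ, AbsolutelyContinuousOnInterval
      (fun s => (ω s : ℂ) * WeightedWeyl.weylIntegral ψ ω (1 - α) σ s) a b := by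
    rw [hprim']
    exact WeightedWeyl.absolutelyContinuousOnInterval_integral_Iic hri
  have hsolve : ∀ᵐ t : ℝ, WeightedWeyl.weylDeriv ψ ω α σ t + (lam : ℂ) * σ t = f t := by
    filter_upwards [WeightedWeyl.ae_hasDerivAt_integral_Iic hri] with t ht
    rw [WeightedWeyl.weylDeriv, hprim', ht.deriv, WeightedWeyl.residual, ← mul_assoc,
      ← Complex.ofReal_mul, one_div_mul_cancel (mul_pos (hω_pos t) (hψ_pos t)).ne']
    push_cast
    ring
  refine ⟨?_, ⟨(hiff σ).2 hσi, _, ⟨Eventually.of_forall fun t => ?_, _, hAC,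
      Eventually.of_forall fun t => rfl, Eventually.of_forall fun t => rfl⟩, hsolve⟩, hAC, hsolve,
    fun σ' hσ' => hψ.ae_eq_weightedConv_of_isSolution hω_meas hω_pos hα hlam hf hσ', ?_,
    hψ.weightedConv_greenFunction_eq_integral hω_pos f⟩
  · filter_upwards [hψ.ae_comp_iff.2 (WeightedWeyl.ae_integrable_kernelConv hKi hf)] with t ht
    refine ((hψ.integrable_comp_iff _).2 ht).congr (Eventually.of_forall fun τ => ?_)
    exact (hψ.convIntegrand_greenFunction hω_pos f t τ).symm
  · refine hψ.integrableOn_weylIntegrand hα ?_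
    rw [hσT]
    exact (WeightedWeyl.boundedConv_fracKernel hα hlam).integrable_left
      (WeightedWeyl.measurable_causal WeightedWeyl.measurable_fracKernel)
      (WeightedWeyl.measurable_causal (WeightedWeyl.measurable_resolventKernel hα.1)) hf (ψ t)
  · intro g T _ hfg t ht
    rw [hσ, hψ.weightedConv_greenFunction_eq_integral hω_pos,
      hψ.weightedConv_greenFunction_eq_integral hω_pos]
    congr 1
    refine setIntegral_congr_ae measurableSet_Iic ?_
    filter_upwards [hfg] with τ h hτ
    rw [h (hτ.trans ht)]
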